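/- Let $G$ be a finite simple cubic (that is, $3$-regular) graph that has a Hamiltonian cycle. Then $G$ has a straight-line drawing in the plane in which every edge has one of the four basic slopes $0,\ \pi/4,\ \pi/2,\ 3\pi/4$ (angles with the $x$-axis). Here a straight-line drawing of $G$ represents the vertices of $G$ by pairwise distinct points of $\mathbb{R}^2$ and every edge by the straight-line segment joining the points of its two end vertices, such that no such segment passes through the point of a vertex other than its two ends; edges are allowed to cross. -/

import Mathlib

/-- The Euclidean plane. -/
abbrev Plane : Type := EuclideanSpace ℝ (Fin 2)

/-- A straight-line drawing of a graph in the plane: vertices are distinct points, an edge `uv` is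
the closed segment joining the points of `u` and `v`, and this segment contains the point of no
vertex other than `u` and `v`. (Edges may cross.) -/
structure StraightLineDrawing {V : Type*} (G : SimpleGraph V) where
  /-- the point representing a vertex -/
  pos : V → Plane
  pos_injective : Function.Injective pos
  pos_notMem_segment : ∀ ⦃u v w : V⦄, G.Adj u v → w ≠ u → w ≠ v →
    pos w ∉ segment ℝ (pos u) (pos v)

/-- The segment between distinct points `p` and `q` has slope `θ` (an angle with the `x`-axis):
the vector from `p` to `q` is parallel to `(cos θ, sin θ)`. -/
def HasSlope (p q : Plane) (θ : ℝ) : Prop :=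
  p ≠ q ∧ ∃ t : ℝ, q - p = t • (!₂[Real.cos θ, Real.sin θ] : Plane)

/-- The four basic slopes. -/
def basicSlopes : Set ℝ := {0, Real.pi / 4, Real.pi / 2, 3 * Real.pi / 4}

/-- Every edge of the drawing has a slope in `S`. -/
def StraightLineDrawing.UsesOnlySlopes {V : Type*} {G : SimpleGraph V}
    (D : StraightLineDrawing G) (S : Set ℝ) : Prop :=
  ∀ ⦃u v : V⦄, G.Adj u v → ∃ θ ∈ S, HasSlope (D.pos u) (D.pos v) θ

/-! Label the vertices along the Hamiltonian cycle by `ZMod n`; the other edges form a perfect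
matching `π` of chords. Draw the chords vertically and give the cycle edges slopes `s k` in {-1, 0,
1}. The abscissas are then one free number per chord, subject to one linear equation saying that the
polygon closes up. Each unwanted incidence (two chords on one vertical line, a foreign vertex on the
line of a cycle edge) is also a linear equation. A real vector space is not a finite union of proper
subspaces, so it suffices that none of these equations holds identically: this is `IsGenericSlopes`,
exploited in `IsGenericSlopes.exists_coordinates`.

A line form vanishes on the solution space only if it is a multiple `r` of the closing form. If no
turn and no chord turn is zero, every chord except that of one vertex `w` must then have exactly one
end on the arc between the line's edge and `w`, and its turn there is the fraction `r` of the chord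
turn (`exists_ratio_of_proportional`). To prevent this, put signs `σ` on the chords and choose the
slopes with turn congruent to `σ` modulo three, so that each turn is `σ` or `-2σ`. If some chord has
different turns at its ends, then `r` is -1 or 2, and summing turns over the arc and over the cycle
contradicts a nonzero total sign (`IsChordPairing.isGenericSlopes_of_sign`).

Such signs need a total that is a nonzero multiple of three, and a chord between whose ends the
signs do not sum to a multiple of three. If some chord is not a diameter, this is arranged by
choosing which of two chords to make negative
(`IsChordPairing.exists_isGenericSlopes_of_not_antipodal`). The cases left are diameters only, where
antisymmetric slopes make the closing equation void; `n = 8` and part of `n = 12`, by finite check;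
and four vertices, placed on a square. -/

/-! ### Chord pairings and slope assignments on a cycle -/

/-- The chords of a cubic graph with Hamiltonian cycle `0, 1, …, n - 1`, as a map sending a vertex
to the other end of its chord. -/
structure IsChordPairing {n : ℕ} (π : ZMod n → ZMod n) : Prop where
  invol : ∀ k, π (π k) = k
  ne_self : ∀ k, π k ≠ k
  ne_succ : ∀ k, π k ≠ k + 1

/-- The change of slope at the vertex `k`, where `s k` is the slope of the edge from `k` to
`k + 1`. -/
def turn {n : ℕ} (s : ZMod n → ℤ) (k : ZMod n) : ℤ := s (k - 1) - s k

/-- How far the vertex `i + 1 + d` lies above the line through `i` and `i + 1`, in terms of the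
abscissas `x` of the vertices. -/
def lineForm {n : ℕ} {R : Type*} [CommRing R] (s : ZMod n → ℤ) (i : ZMod n) (d : ℕ)
    (x : ZMod n → R) : R :=
  ∑ t ∈ Finset.range d, ((s (i + 1 + t) - s i : ℤ) : R) * (x (i + 1 + t + 1) - x (i + 1 + t))

/-- Abscissas of the vertices such that chords are vertical and the polygon with slopes `s`
closes up. -/
def IsClosing {n : ℕ} [NeZero n] {R : Type*} [CommRing R] (π : ZMod n → ZMod n) (s : ZMod n → ℤ)
    (x : ZMod n → R) : Prop :=
  (∀ k, x (π k) = x k) ∧ ∑ k, (turn s k : R) * x k = 0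

/-- Slopes for the edges of the cycle such that no unwanted incidence is forced. -/
structure IsGenericSlopes {n : ℕ} [NeZero n] (π : ZMod n → ZMod n) (s : ZMod n → ℤ) : Prop where
  mem : ∀ k, s k = -1 ∨ s k = 0 ∨ s k = 1
  separates : ∀ j k, j ≠ k → j ≠ π k → ∃ x : ZMod n → ℤ, IsClosing π s x ∧ x j ≠ x k
  avoids : ∀ i d, 1 ≤ d → d + 2 ≤ n → ∃ x : ZMod n → ℤ, IsClosing π s x ∧ lineForm s i d x ≠ 0

section Cycle

variable {n : ℕ}

lemma sum_range_natCast_zmod [NeZero n] {M : Type*} [AddCommMonoid M] (g : ZMod n → M) :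
    ∑ t ∈ Finset.range n, g t = ∑ k, g k := by
  refine Finset.sum_nbij' (fun t => (t : ZMod n)) ZMod.val ?_ ?_ ?_ ?_ ?_
  · simp
  · intro k _; simpa using ZMod.val_lt k
  · intro t ht; exact ZMod.val_cast_of_lt (Finset.mem_range.1 ht)
  · intro k _; exact ZMod.natCast_zmod_val k
  · intro t _; rfl

/-- On a cycle the total is the only obstruction to integrating increments: partial sums from `0`
work, and `hg` is what closes the step from `n - 1` back to `0`. Used for ordinates over the reals
and for slopes modulo three. -/
lemma exists_primitive [NeZero n] {M : Type*} [AddCommGroup M] (g : ZMod n → M)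
    (hg : ∑ k, g k = 0) :
    ∃ q : ZMod n → M, ∀ k, q (k + 1) - q k = g k := by
  refine ⟨fun k => ∑ t ∈ Finset.range k.val, g t, fun k => ?_⟩
  have hk := ZMod.val_lt k
  rcases Nat.lt_or_ge (k.val + 1) n with h | h
  · have : (k + 1).val = k.val + 1 := by
      conv_lhs => rw [← ZMod.natCast_zmod_val k]
      have : ((k.val : ZMod n) + 1) = ((k.val + 1 : ℕ) : ZMod n) := by push_cast; rfl
      rw [this, ZMod.val_cast_of_lt h]
    simp only [this, Finset.sum_range_succ, ZMod.natCast_zmod_val]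
    abel
  · have hn : k.val + 1 = n := by omega
    have h0 : k + 1 = 0 := by
      have : ((k.val + 1 : ℕ) : ZMod n) = 0 := by rw [hn]; simp
      simpa using this
    have h1 := sum_range_natCast_zmod g
    rw [hg, show Finset.range n = Finset.range (k.val + 1) by rw [hn],
      Finset.sum_range_succ, ZMod.natCast_zmod_val] at h1
    simp only [h0, ZMod.val_zero, Finset.range_zero, Finset.sum_empty, zero_sub]
    rw [neg_eq_iff_add_eq_zero, h1]

lemma sum_range_sub_add {M : Type*} [AddCommGroup M] (q : ZMod n → M) (i : ZMod n) (d : ℕ) :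
    ∑ t ∈ Finset.range d, (q (i + t + 1) - q (i + t)) = q (i + d) - q i := by
  induction d with
  | zero => simp
  | succ d ih =>
    rw [Finset.sum_range_succ, ih]
    push_cast
    rw [← add_assoc]
    abel

lemma sum_turn_mul [NeZero n] {R : Type*} [CommRing R] (s : ZMod n → ℤ) (x : ZMod n → R) :
    ∑ k, (turn s k : R) * x k = ∑ k, (s k : R) * (x (k + 1) - x k) := by
  have h : ∑ k, (s (k - 1) : R) * x k = ∑ k, (s k : R) * x (k + 1) := by
    rw [← Equiv.sum_comp (Equiv.addRight (1 : ZMod n))]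
    simp
  simp only [turn, Int.cast_sub, sub_mul, mul_sub, Finset.sum_sub_distrib, h]

/-- Telescoping of `y - s i * x`; this identifies the combinatorial form with the vertical distance
to the line of the edge at `i`. -/
lemma lineForm_eq_of_primitive {R : Type*} [CommRing R] (s : ZMod n → ℤ) (x y : ZMod n → R)
    (hy : ∀ k, y (k + 1) - y k = s k * (x (k + 1) - x k)) (i : ZMod n) (d : ℕ) :
    lineForm s i d x = (y (i + 1 + d) - y i) - s i * (x (i + 1 + d) - x i) := by
  have h := sum_range_sub_add (fun k => y k - s i * x k) (i + 1) d
  have h2 : lineForm s i d x = ∑ t ∈ Finset.range d, ((y (i + 1 + t + 1) - s i * x (i + 1 + t + 1))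
      - (y (i + 1 + t) - s i * x (i + 1 + t))) := by
    refine Finset.sum_congr rfl fun t _ => ?_
    have := hy (i + 1 + t)
    push_cast
    linear_combination -this
  rw [h2, h]
  linear_combination -(hy i)

lemma exists_offset [NeZero n] {i w : ZMod n} (h1 : w ≠ i) (h2 : w ≠ i + 1) :
    ∃ d : ℕ, 1 ≤ d ∧ d + 2 ≤ n ∧ w = i + 1 + d := by
  have hlt := ZMod.val_lt (w - (i + 1))
  have hc : ((w - (i + 1)).val : ZMod n) = w - (i + 1) := ZMod.natCast_zmod_val _
  refine ⟨(w - (i + 1)).val, ?_, ?_, by rw [hc]; ring⟩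
  · by_contra h
    have : (w - (i + 1)).val = 0 := by omega
    rw [this] at hc
    apply h2
    rw [← sub_eq_zero, ← hc]; simp
  · by_contra h
    have h' : (w - (i + 1)).val + 1 = n := by omega
    have : (((w - (i + 1)).val + 1 : ℕ) : ZMod n) = 0 := by rw [h']; simp
    rw [Nat.cast_add, hc] at this
    apply h1
    rw [← sub_eq_zero, ← this]; push_cast; ring

/-- Generic slopes admit coordinates without any unwanted incidence. -/
theorem IsGenericSlopes.exists_coordinates [NeZero n] {π : ZMod n → ZMod n} {s : ZMod n → ℤ}
    (hs : IsGenericSlopes π s) :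
    ∃ x y : ZMod n → ℝ, (∀ k, x (π k) = x k) ∧
      (∀ k, y (k + 1) - y k = s k * (x (k + 1) - x k)) ∧
      (∀ j k, j ≠ k → j ≠ π k → x j ≠ x k) ∧
      ∀ i w, w ≠ i → w ≠ i + 1 → y w - y i ≠ s i * (x w - x i) := by
  let W : Submodule ℝ (ZMod n → ℝ) :=
    { carrier := {x | IsClosing π s x}
      zero_mem' := ⟨by simp, by simp⟩
      add_mem' := by
        rintro a b ⟨ha, ha'⟩ ⟨hb, hb'⟩
        exact ⟨fun k => by simp [ha, hb], by
          simp only [Pi.add_apply, mul_add, Finset.sum_add_distrib, ha', hb', add_zero]⟩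
      smul_mem' := by
        rintro c a ⟨ha, ha'⟩
        refine ⟨fun k => by simp [ha], ?_⟩
        have : ∑ k, (turn s k : ℝ) * (c • a) k = c * ∑ k, (turn s k : ℝ) * a k := by
          rw [Finset.mul_sum]
          exact Finset.sum_congr rfl fun k _ => by simp; ring
        rw [this, ha', mul_zero] }
  let e : ZMod n → Module.Dual ℝ (ZMod n → ℝ) := fun k => LinearMap.proj k
  let D : ZMod n × ZMod n → Module.Dual ℝ (ZMod n → ℝ) := fun p =>
    e p.1 - e p.2
  let Lf : ZMod n × ℕ → Module.Dual ℝ (ZMod n → ℝ) := fun p =>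
    ∑ t ∈ Finset.range p.2, ((s (p.1 + 1 + t) - s p.1 : ℤ) : ℝ) •
      (e (p.1 + 1 + t + 1) - e (p.1 + 1 + t))
  have hLf : ∀ p x, Lf p x = lineForm s p.1 p.2 x := by
    intro p x
    simp [Lf, e, lineForm, LinearMap.sum_apply]
  have hcast : ∀ x : ZMod n → ℤ, IsClosing π s x → IsClosing π s (fun k => (x k : ℝ)) := by
    rintro x ⟨h1, h2⟩
    refine ⟨fun k => by simp [h1], ?_⟩
    simpa using congrArg (Int.cast : ℤ → ℝ) h2
  let ι := {p : ZMod n × ZMod n // p.1 ≠ p.2 ∧ p.1 ≠ π p.2} ⊕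
    {p : ZMod n × Fin n // 1 ≤ p.2.val ∧ p.2.val + 2 ≤ n}
  let f : ι → Module.Dual ℝ (ZMod n → ℝ) :=
    Sum.elim (fun p => D p.1) (fun p => Lf (p.1.1, p.1.2.val))
  -- One point of `W` avoids finitely many hyperplanes at once, since each form is nonzero at some
  -- integer point of `W`.
  obtain ⟨x, hxW, hx⟩ := Module.Dual.exists_forall_mem_ne_zero_of_forall_exists W f (by
    rintro (⟨⟨j, k⟩, h1, h2⟩ | ⟨⟨i, d⟩, h1, h2⟩)
    · obtain ⟨x, hx, hne⟩ := hs.separates j k h1 h2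
      refine ⟨fun k => (x k : ℝ), hcast x hx, ?_⟩
      simpa [f, D, e, sub_eq_zero] using hne
    · obtain ⟨x, hx, hne⟩ := hs.avoids i d h1 h2
      refine ⟨fun k => (x k : ℝ), hcast x hx, ?_⟩
      simp only [f, Sum.elim_inr, hLf]
      have : lineForm s i d (fun k => (x k : ℝ)) = ((lineForm s i d x : ℤ) : ℝ) := by
        simp [lineForm]
      rw [this]
      exact_mod_cast hne)
  obtain ⟨hx1, hx2⟩ : IsClosing π s x := hxW
  rw [sum_turn_mul] at hx2
  obtain ⟨y, hy⟩ := exists_primitive _ hx2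
  refine ⟨x, y, hx1, hy, ?_, ?_⟩
  · intro j k h1 h2 h
    exact hx (Sum.inl ⟨(j, k), h1, h2⟩) (by simp [f, D, e, h])
  · intro i w h1 h2 h
    obtain ⟨d, hd1, hd2, rfl⟩ := exists_offset h1 h2
    refine hx (Sum.inr ⟨(i, ⟨d, by omega⟩), hd1, hd2⟩) ?_
    simp only [f, Sum.elim_inr, hLf]
    rw [lineForm_eq_of_primitive s x y hy, h, sub_self]

end Cycle

/-! ### From generic slopes to a drawing -/

lemma plane_ext {p q : Plane} (h0 : p 0 = q 0) (h1 : p 1 = q 1) : p = q := by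
  ext i
  fin_cases i
  · exact h0
  · exact h1

lemma coord_eq_of_mem_segment {p q r : Plane} (h : r ∈ segment ℝ p q) :
    ∃ t : ℝ, ∀ i, r i - p i = t * (q i - p i) := by
  rw [segment_eq_image'] at h
  obtain ⟨t, -, rfl⟩ := h
  exact ⟨t, fun i => by simp⟩

lemma hasSlope_zero {p q : Plane} (hpq : p ≠ q) (h : q 1 = p 1) : HasSlope p q 0 :=
  ⟨hpq, q 0 - p 0, plane_ext (by simp) (by simp [h])⟩

lemma hasSlope_pi_div_two {p q : Plane} (hpq : p ≠ q) (h : q 0 = p 0) :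
    HasSlope p q (Real.pi / 2) :=
  ⟨hpq, q 1 - p 1, plane_ext (by simp [h]) (by simp)⟩

lemma hasSlope_pi_div_four {p q : Plane} (hpq : p ≠ q) (h : q 1 - p 1 = q 0 - p 0) :
    HasSlope p q (Real.pi / 4) := by
  refine ⟨hpq, (q 0 - p 0) * √2, plane_ext ?_ ?_⟩ <;>
  · simp only [PiLp.sub_apply, PiLp.smul_apply, smul_eq_mul, Real.cos_pi_div_four,
      Real.sin_pi_div_four, Matrix.cons_val_zero, Matrix.cons_val_one, h]
    have := Real.mul_self_sqrt (show (0 : ℝ) ≤ 2 by norm_num)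
    linear_combination -(q 0 - p 0) / 2 * this

lemma hasSlope_three_pi_div_four {p q : Plane} (hpq : p ≠ q) (h : q 1 - p 1 = -(q 0 - p 0)) :
    HasSlope p q (3 * Real.pi / 4) := by
  have hθ : 3 * Real.pi / 4 = Real.pi - Real.pi / 4 := by ring
  have := Real.mul_self_sqrt (show (0 : ℝ) ≤ 2 by norm_num)
  refine ⟨hpq, -(q 0 - p 0) * √2, plane_ext ?_ ?_⟩
  · simp only [hθ, PiLp.sub_apply, PiLp.smul_apply, smul_eq_mul, Real.cos_pi_sub,
      Real.sin_pi_sub, Real.cos_pi_div_four,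
      Matrix.cons_val_zero]
    linear_combination -(q 0 - p 0) / 2 * this
  · simp only [hθ, PiLp.sub_apply, PiLp.smul_apply, smul_eq_mul, Real.cos_pi_sub,
      Real.sin_pi_sub, Real.cos_pi_div_four,
      Real.sin_pi_div_four, Matrix.cons_val_zero, Matrix.cons_val_one, h]
    linear_combination (q 0 - p 0) / 2 * this

/-- Two points joined by a line of slope `-1`, `0`, `1` or a vertical line are in a basic
direction. -/
lemma exists_basicSlope {p q : Plane} (hpq : p ≠ q)
    (h : q 0 = p 0 ∨ q 1 = p 1 ∨ q 1 - p 1 = q 0 - p 0 ∨ q 1 - p 1 = -(q 0 - p 0)) :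
    ∃ θ ∈ basicSlopes, HasSlope p q θ := by
  rcases h with h | h | h | h
  · exact ⟨_, by simp [basicSlopes], hasSlope_pi_div_two hpq h⟩
  · exact ⟨_, by simp [basicSlopes], hasSlope_zero hpq h⟩
  · exact ⟨_, by simp [basicSlopes], hasSlope_pi_div_four hpq h⟩
  · exact ⟨_, by simp [basicSlopes], hasSlope_three_pi_div_four hpq h⟩

theorem IsGenericSlopes.exists_drawing {n : ℕ} [NeZero n] {V : Type*} {G : SimpleGraph V}
    (v : ZMod n ≃ V) {π : ZMod n → ZMod n} {s : ZMod n → ℤ} (hπ : IsChordPairing π)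
    (hs : IsGenericSlopes π s)
    (hadj : ∀ j k, G.Adj (v j) (v k) → k = j + 1 ∨ j = k + 1 ∨ k = π j) :
    ∃ D : StraightLineDrawing G, D.UsesOnlySlopes basicSlopes := by
  obtain ⟨x, y, hx, hy, hsep, hline⟩ := hs.exists_coordinates
  let P : ZMod n → Plane := fun k => !₂[x k, y k]
  have hPx : ∀ k, P k 0 = x k := fun k => rfl
  have hPy : ∀ k, P k 1 = y k := fun k => rfl
  have hP : Function.Injective P := by
    intro j k h
    by_contra hne
    have h0 : x j = x k := by rw [← hPx, h, hPx]
    have h1 : y j = y k := by rw [← hPy, h, hPy]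
    have hj : j = π k := by
      by_contra h'
      exact hsep j k hne h' h0
    -- The ends of a chord share an abscissa, but `j` is off the line of the cycle edge at `k`, so
    -- the ordinates differ.
    refine hline k j hne (fun h' => hπ.ne_succ k (by rw [← hj, h'])) ?_
    rw [h0, h1]; ring
  have hcyc : ∀ i w, w ≠ i → w ≠ i + 1 → P w ∉ segment ℝ (P i) (P (i + 1)) := by
    intro i w h1 h2 h
    obtain ⟨t, ht⟩ := coord_eq_of_mem_segment h
    have e0 := ht 0
    have e1 := ht 1
    simp only [hPx, hPy] at e0 e1
    exact hline i w h1 h2 (by rw [e0, e1, hy]; ring)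
  refine ⟨⟨fun u => P (v.symm u), hP.comp v.symm.injective, ?_⟩, ?_⟩
  · intro u u' u'' hA hu hu'
    obtain ⟨j, rfl⟩ := v.surjective u
    obtain ⟨k, rfl⟩ := v.surjective u'
    obtain ⟨w, rfl⟩ := v.surjective u''
    have hwj : w ≠ j := fun h => hu (by rw [h])
    have hwk : w ≠ k := fun h => hu' (by rw [h])
    simp only [Equiv.symm_apply_apply]
    rcases hadj j k hA with rfl | rfl | rfl
    · exact hcyc j w hwj hwk
    · rw [segment_symm]
      exact hcyc k w hwk hwj
    · intro h
      obtain ⟨t, ht⟩ := coord_eq_of_mem_segment h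
      have e0 := ht 0
      simp only [hPx, hx] at e0
      exact hsep w j hwj hwk (by linarith)
  · intro u u' hA
    obtain ⟨j, rfl⟩ := v.surjective u
    obtain ⟨k, rfl⟩ := v.surjective u'
    have hjk : j ≠ k := fun h => hA.ne (by rw [h])
    simp only [Equiv.symm_apply_apply]
    refine exists_basicSlope (hP.ne hjk) ?_
    simp only [hPx, hPy]
    rcases hadj j k hA with rfl | rfl | rfl
    · have e := hy j
      rcases hs.mem j with h | h | h <;> simp only [h] at e <;> push_cast at e
      · right; right; right; linarith
      · right; left; linarith
      · right; right; left; linarith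
    · have e := hy k
      rcases hs.mem k with h | h | h <;> simp only [h] at e <;> push_cast at e
      · right; right; right; linarith
      · right; left; linarith
      · right; right; left; linarith
    · left; exact hx j

/-- The corners of a square draw every graph on four vertices. -/
theorem exists_drawing_of_equiv_fin_four {V : Type*} (G : SimpleGraph V) (v : V ≃ Fin 4) :
    ∃ D : StraightLineDrawing G, D.UsesOnlySlopes basicSlopes := by
  let P : Fin 4 → Plane := ![!₂[0, 0], !₂[1, 0], !₂[0, 1], !₂[1, 1]]
  have hP : Function.Injective P := by
    intro i j h
    have h0 := congrArg (fun p : Plane => p 0) h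
    have h1 := congrArg (fun p : Plane => p 1) h
    fin_cases i <;> fin_cases j <;> simp [P] at h0 h1 ⊢
  refine ⟨⟨fun u => P (v u), hP.comp v.injective, ?_⟩, ?_⟩
  · intro a b c hA ha hb h
    obtain ⟨t, ht⟩ := coord_eq_of_mem_segment h
    have h0 := ht 0
    have h1 := ht 1
    have hab := v.injective.ne hA.ne
    have hca := v.injective.ne ha
    have hcb := v.injective.ne hb
    revert h0 h1 hab hca hcb
    generalize v a = i, v b = j, v c = k
    fin_cases i <;> fin_cases j <;> fin_cases k <;> simp [P] <;> intros <;> linarith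
  · intro a b hA
    have hab := v.injective.ne hA.ne
    refine exists_basicSlope (hP.ne hab) ?_
    revert hab
    dsimp only
    generalize v a = i, v b = j
    fin_cases i <;> fin_cases j <;> simp [P]

/-! ### Labelling a Hamiltonian cubic graph -/

/-- A Hamiltonian cycle labels the vertices by residues so that consecutive residues are
adjacent. -/
lemma exists_cyclic_labelling {V : Type*} [Fintype V] [DecidableEq V] {G : SimpleGraph V} {a : V}
    {p : G.Walk a a} (hp : p.IsHamiltonianCycle) {n : ℕ} [NeZero n] (hn : Fintype.card V = n) :
    ∃ v : ZMod n ≃ V, ∀ k, G.Adj (v k) (v (k + 1)) := by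
  have hlen : p.length = n := by rw [hp.length_eq, hn]
  have hinj : Function.Injective (fun k : ZMod n => p.getVert k.val) := by
    intro j k h
    have hj := ZMod.val_lt j
    have hk := ZMod.val_lt k
    exact ZMod.val_injective n (hp.isCycle.getVert_injOn' (by simp; omega) (by simp; omega) h)
  have hbij := (Fintype.bijective_iff_injective_and_card (fun k : ZMod n => p.getVert k.val)).2
    ⟨hinj, by rw [ZMod.card, hn]⟩
  refine ⟨Equiv.ofBijective _ hbij, fun k => ?_⟩
  have hk := ZMod.val_lt k
  have hadj := p.adj_getVert_succ (i := k.val) (by omega)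
  have hsucc : ((k.val + 1 : ℕ) : ZMod n) = k + 1 := by simp
  have : p.getVert (k + 1).val = p.getVert (k.val + 1) := by
    rcases Nat.lt_or_ge (k.val + 1) n with h | h
    · rw [← hsucc, ZMod.val_cast_of_lt h]
    · have h' : k.val + 1 = n := by omega
      rw [← hsucc, h', ZMod.natCast_self, ZMod.val_zero, p.getVert_zero, ← hlen,
        p.getVert_length]
  simpa [this] using hadj

lemma exists_chordPairing {V : Type*} [Fintype V] [DecidableEq V] {G : SimpleGraph V}
    [DecidableRel G.Adj] (hcubic : G.IsRegularOfDegree 3) {n : ℕ} (hn : 3 ≤ n)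
    (v : ZMod n ≃ V) (hv : ∀ k, G.Adj (v k) (v (k + 1))) :
    ∃ π : ZMod n → ZMod n, IsChordPairing π ∧
      ∀ j k, G.Adj (v j) (v k) → k = j + 1 ∨ j = k + 1 ∨ k = π j := by
  -- The two cycle neighbours are distinct because `n ≥ 3`, so degree three leaves exactly one
  -- further neighbour.
  have htwo : ∀ k : ZMod n, k + 1 ≠ k - 1 := by
    intro k h
    have : ((2 : ℕ) : ZMod n) = 0 := by push_cast; linear_combination h
    rw [ZMod.natCast_eq_zero_iff] at this
    exact absurd (Nat.le_of_dvd (by norm_num) this) (by omega)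
  have hv' : ∀ k, G.Adj (v k) (v (k - 1)) := fun k => by simpa using (hv (k - 1)).symm
  have hthird : ∀ k, ∃ l, ∀ j, G.Adj (v k) (v j) ∧ j ≠ k + 1 ∧ j ≠ k - 1 ↔ j = l := by
    intro k
    have hcard : ((G.neighborFinset (v k)) \ {v (k + 1), v (k - 1)}).card = 1 := by
      rw [Finset.card_sdiff_of_subset, G.card_neighborFinset_eq_degree, hcubic (v k),
        Finset.card_pair (v.injective.ne (htwo k))]
      intro u hu
      simp only [Finset.mem_insert, Finset.mem_singleton] at hu
      rcases hu with rfl | rfl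
      · simpa using hv k
      · simpa using hv' k
    obtain ⟨u, hu⟩ := Finset.card_eq_one.1 hcard
    refine ⟨v.symm u, fun j => ?_⟩
    have := congrArg (fun S => v j ∈ S) hu
    simpa [Equiv.eq_symm_apply, v.injective.eq_iff] using this
  choose π hπ using hthird
  have hπ1 : ∀ k, G.Adj (v k) (v (π k)) ∧ π k ≠ k + 1 ∧ π k ≠ k - 1 := fun k => (hπ k _).2 rfl
  refine ⟨π, ⟨fun k => ?_, fun k h => ?_, fun k => (hπ1 k).2.1⟩, fun j k h => ?_⟩
  · obtain ⟨h1, h2, h3⟩ := hπ1 k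
    refine ((hπ (π k) k).1 ⟨h1.symm, fun h => h3 ?_, fun h => h2 ?_⟩).symm
    · linear_combination -h
    · linear_combination -h
  · have := (hπ1 k).1
    rw [h] at this
    exact G.loopless.irrefl _ this
  · by_cases h1 : k = j + 1
    · exact Or.inl h1
    · by_cases h2 : k = j - 1
      · exact Or.inr (Or.inl (by rw [h2]; ring))
      · exact Or.inr (Or.inr ((hπ j k).1 ⟨h, h1, h2⟩))

/-! ### A criterion for generic slopes -/

section Criterion

variable {n : ℕ}

/-- The sum of the turns at the two ends of the chord at `k`. -/
def chordTurn (π : ZMod n → ZMod n) (s : ZMod n → ℤ) (k : ZMod n) : ℤ := turn s k + turn s (π k)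

/-- The `d` vertices following `i` on the cycle. -/
def arc (i : ZMod n) (d : ℕ) : Finset (ZMod n) :=
  (Finset.range d).image fun t : ℕ => i + 1 + (t : ZMod n)

lemma natCast_injOn_lt {t u : ℕ} (ht : t < n) (hu : u < n) (h : (t : ZMod n) = u) : t = u := by
  rwa [ZMod.natCast_eq_natCast_iff', Nat.mod_eq_of_lt ht, Nat.mod_eq_of_lt hu] at h

lemma sum_arc {M : Type*} [AddCommMonoid M] (i : ZMod n) {d : ℕ} (hd : d ≤ n) (g : ZMod n → M) :
    ∑ k ∈ arc i d, g k = ∑ t ∈ Finset.range d, g (i + 1 + t) := by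
  refine Finset.sum_image fun t ht u hu h => ?_
  simp only [Finset.coe_range, Set.mem_Iio] at ht hu
  exact natCast_injOn_lt (by omega) (by omega) (add_left_cancel h)

lemma add_natCast_mem_arc_iff (i : ZMod n) {d t : ℕ} (hd : d ≤ n) (ht : t < n) :
    i + 1 + (t : ZMod n) ∈ arc i d ↔ t < d := by
  simp only [arc, Finset.mem_image, Finset.mem_range]
  constructor
  · rintro ⟨u, hu, h⟩
    rwa [← natCast_injOn_lt (by omega) ht (add_left_cancel h)]
  · exact fun h => ⟨t, h, rfl⟩

lemma self_eq_add_natCast (i : ZMod n) (hn : 1 ≤ n) : i = i + 1 + ((n - 1 : ℕ) : ZMod n) := by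
  push_cast [hn]
  simp

lemma self_notMem_arc (i : ZMod n) {d : ℕ} (hd : d + 1 ≤ n) : i ∉ arc i d := by
  have h := add_natCast_mem_arc_iff i (d := d) (t := n - 1) (by omega) (by omega)
  rw [← self_eq_add_natCast i (by omega)] at h
  rw [h]
  omega

lemma pred_notMem_arc (i : ZMod n) {d : ℕ} (hd : d + 2 ≤ n) : i - 1 ∉ arc i d := by
  have h : i - 1 = i + 1 + ((n - 2 : ℕ) : ZMod n) := by
    rw [Nat.cast_sub (by omega)]
    push_cast
    rw [ZMod.natCast_self]
    ring
  rw [h, add_natCast_mem_arc_iff i (by omega) (by omega)]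
  omega

lemma succ_mem_arc (i : ZMod n) {d : ℕ} (hd : 1 ≤ d) : i + 1 ∈ arc i d :=
  Finset.mem_image.2 ⟨0, Finset.mem_range.2 hd, by simp⟩

lemma succ_succ_mem_arc (i : ZMod n) {d : ℕ} (hd : 2 ≤ d) : i + 1 + 1 ∈ arc i d :=
  Finset.mem_image.2 ⟨1, Finset.mem_range.2 hd, by simp⟩

lemma add_notMem_arc (i : ZMod n) {d : ℕ} (hd : d + 1 ≤ n) : i + 1 + (d : ZMod n) ∉ arc i d := by
  rw [add_natCast_mem_arc_iff i (by omega) (by omega)]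
  omega

lemma sum_arc_turn (s : ZMod n → ℤ) (i : ZMod n) {d : ℕ} (hd : d ≤ n) :
    ∑ k ∈ arc i d, turn s k = s i - s (i + d) := by
  rw [sum_arc i hd]
  have := sum_range_sub_add s i d
  rw [← neg_sub, ← this, ← Finset.sum_neg_distrib]
  refine Finset.sum_congr rfl fun t _ => ?_
  rw [turn, neg_sub]
  congr 2 <;> ring

/-- Abel summation: each vertex of the arc gets its turn as coefficient, and only the far vertex `i
+ 1 + d` gets something else. Hence that vertex's chord is exempted in the criterion. -/
lemma lineForm_eq_sum_arc (s : ZMod n → ℤ) (i : ZMod n) {d : ℕ} (hd : d ≤ n) (x : ZMod n → ℤ) :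
    lineForm s i d x = ∑ k ∈ arc i d, turn s k * x k + (s (i + d) - s i) * x (i + 1 + d) := by
  rw [sum_arc i hd]
  clear hd
  induction d with
  | zero => simp [lineForm]
  | succ d ih =>
    have h1 : lineForm s i (d + 1) x = lineForm s i d x +
        (s (i + 1 + d) - s i) * (x (i + 1 + d + 1) - x (i + 1 + d)) := by
      simp [lineForm, Finset.sum_range_succ]
    rw [h1, ih, Finset.sum_range_succ, turn]
    have e1 : i + 1 + (d : ZMod n) - 1 = i + d := by ring
    have e2 : i + ((d + 1 : ℕ) : ZMod n) = i + 1 + d := by push_cast; ring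
    have e3 : i + 1 + ((d + 1 : ℕ) : ZMod n) = i + 1 + d + 1 := by push_cast; ring
    rw [e1, e2, e3]
    ring

/-- The indicator of the two ends of the chord at `k`. -/
def chordIndicator (π : ZMod n → ZMod n) (k j : ZMod n) : ℤ :=
  (if j = k then 1 else 0) + (if j = π k then 1 else 0)

lemma sum_mul_chordIndicator (π : ZMod n → ZMod n) (k : ZMod n) (S : Finset (ZMod n))
    (g : ZMod n → ℤ) : ∑ j ∈ S, g j * chordIndicator π k j =
      (if k ∈ S then g k else 0) + (if π k ∈ S then g (π k) else 0) := by
  simp only [chordIndicator, mul_add, mul_ite, mul_one, mul_zero, Finset.sum_add_distrib,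
    Finset.sum_ite_eq']

lemma IsChordPairing.chordIndicator_apply {π : ZMod n → ZMod n} (hπ : IsChordPairing π)
    (k j : ZMod n) : chordIndicator π k (π j) = chordIndicator π k j := by
  have h1 : π j = k ↔ j = π k := ⟨fun h => by rw [← h, hπ.invol], fun h => by rw [h, hπ.invol]⟩
  have h2 : π j = π k ↔ j = k :=
    ⟨fun h => by rw [← hπ.invol j, h, hπ.invol], fun h => by rw [h]⟩
  simp only [chordIndicator, h1, h2]
  ring

/-- These two-chord combinations lie in the kernel of the closing form; a form vanishing on all of
them is proportional to it. -/
lemma IsChordPairing.isClosing_sub [NeZero n] {π : ZMod n → ZMod n} (hπ : IsChordPairing π)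
    (s : ZMod n → ℤ) (k l : ZMod n) :
    IsClosing π s fun j =>
      chordTurn π s l * chordIndicator π k j - chordTurn π s k * chordIndicator π l j := by
  refine ⟨fun j => by simp only [hπ.chordIndicator_apply], ?_⟩
  have h : ∀ k, ∑ j, turn s j * chordIndicator π k j = chordTurn π s k := fun k => by
    rw [sum_mul_chordIndicator]; simp [chordTurn]
  simp only [mul_sub, mul_left_comm _ (chordTurn π s _), Finset.sum_sub_distrib, ← Finset.mul_sum,
    Int.cast_id, h]
  ring

lemma IsChordPairing.ne_pred {π : ZMod n → ZMod n} (hπ : IsChordPairing π) (k : ZMod n) :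
    π k ≠ k - 1 := fun h => hπ.ne_succ (k - 1) (by rw [← h, hπ.invol, h]; ring)

lemma IsChordPairing.eq_iff {π : ZMod n → ZMod n} (hπ : IsChordPairing π) {j k : ZMod n} :
    π j = k ↔ j = π k := ⟨fun h => by rw [← h, hπ.invol], fun h => by rw [h, hπ.invol]⟩

/-- If the chord forms `ℓ` of a line are proportional to those of the closing condition, then all
chords but one are separated by the line, with a common ratio. -/
lemma exists_ratio_of_proportional {π : ZMod n → ZMod n} {s : ZMod n → ℤ}
    (ha : ∀ k, turn s k ≠ 0) (hc : ∀ k, chordTurn π s k ≠ 0) {A : Finset (ZMod n)} {w p q : ZMod n}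
    (hp : p ∈ A) (hpw : p ≠ w) (hpw' : p ≠ π w) (hq : q ∉ A) (hqw : q ≠ w) (hqw' : q ≠ π w)
    {ℓ : ZMod n → ℤ} (hprop : ∀ k l, chordTurn π s l * ℓ k = chordTurn π s k * ℓ l)
    (hℓ : ∀ k, k ≠ w → k ≠ π w →
      ℓ k = (if k ∈ A then turn s k else 0) + (if π k ∈ A then turn s (π k) else 0)) :
    ∃ r : ℚ, ∀ k, k ≠ w → k ≠ π w →
      (k ∈ A ↔ π k ∉ A) ∧ (k ∈ A → (turn s k : ℚ) = r * chordTurn π s k) := by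
  have hcQ : ∀ k, (chordTurn π s k : ℚ) ≠ 0 := fun k => by exact_mod_cast hc k
  have haQ : ∀ k, (turn s k : ℚ) ≠ 0 := fun k => by exact_mod_cast ha k
  have hcd : ∀ k, (chordTurn π s k : ℚ) = turn s k + turn s (π k) := fun k => by
    simp [chordTurn]
  obtain ⟨r, hr⟩ : ∃ r : ℚ, ∀ k, (ℓ k : ℚ) = r * chordTurn π s k := by
    refine ⟨ℓ w / chordTurn π s w, fun k => ?_⟩
    have : (chordTurn π s w : ℚ) * ℓ k = chordTurn π s k * ℓ w := by exact_mod_cast hprop k w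
    field_simp [hcQ w]
    linear_combination this
  have hval : ∀ k, k ≠ w → k ≠ π w → r * chordTurn π s k =
      (if k ∈ A then (turn s k : ℚ) else 0) + (if π k ∈ A then (turn s (π k) : ℚ) else 0) := by
    intro k h1 h2
    rw [← hr, hℓ k h1 h2]
    push_cast
    rfl
  -- The chord of `p` has an end in `A`, so its value is a turn or a full chord turn, never zero.
  -- Dually, the chord of `q` has an end outside `A`, so its value is never the full chord turn, and
  -- `r ≠ 1`.
  have hr0 : r ≠ 0 := by
    rintro rfl
    have h := hval p hpw hpw'
    rw [if_pos hp, zero_mul] at h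
    split_ifs at h
    · exact hcQ p (by rw [hcd, ← h])
    · exact haQ p (by linarith)
  have hr1 : r ≠ 1 := by
    rintro rfl
    have h := hval q hqw hqw'
    rw [if_neg hq, one_mul, hcd] at h
    split_ifs at h
    · exact haQ q (by linarith)
    · exact hcQ q (by rw [hcd]; linarith)
  refine ⟨r, fun k h1 h2 => ?_⟩
  have h := hval k h1 h2
  by_cases hk : k ∈ A <;> by_cases hk' : π k ∈ A <;> simp only [hk, hk', if_true, if_false] at h
  · rw [← hcd] at h
    exact absurd (mul_right_cancel₀ (hcQ k) (by rw [h, one_mul])) hr1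
  · exact ⟨by simp [hk, hk'], fun _ => by linarith⟩
  · exact ⟨by simp [hk, hk'], fun h' => absurd h' hk⟩
  · simp only [add_zero, mul_eq_zero, hcQ k, or_false] at h
    exact absurd h hr0

/-- Slopes with nonvanishing turns at vertices and chords are generic, provided that the chords are
not separated with a common ratio. -/
theorem IsChordPairing.isGenericSlopes [NeZero n] {π : ZMod n → ZMod n} (hπ : IsChordPairing π)
    (hn : 5 ≤ n) {s : ZMod n → ℤ} (hs : ∀ k, s k = -1 ∨ s k = 0 ∨ s k = 1)
    (ha : ∀ k, turn s k ≠ 0) (hc : ∀ k, chordTurn π s k ≠ 0)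
    (H : ∀ i d, 1 ≤ d → d + 2 ≤ n → ∀ r : ℚ,
      ¬ ∀ k, k ≠ i + 1 + (d : ZMod n) → k ≠ π (i + 1 + (d : ZMod n)) →
        (k ∈ arc i d ↔ π k ∉ arc i d) ∧ (k ∈ arc i d → (turn s k : ℚ) = r * chordTurn π s k)) :
    IsGenericSlopes π s where
  mem := hs
  separates j k hjk hjk' := by
    -- A third chord, available since `n ≥ 5`, compensates for moving the chord of `j` while that of
    -- `k` stays at `0`.
    obtain ⟨l, hl⟩ : ∃ l, l ∉ ({j, π j, k, π k} : Finset (ZMod n)) := by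
      by_contra! h
      have h1 : (Finset.univ : Finset (ZMod n)) ⊆ {j, π j, k, π k} := fun l _ => h l
      have h2 := Finset.card_le_card h1
      rw [Finset.card_univ, ZMod.card] at h2
      exact absurd (h2.trans Finset.card_le_four) (by omega)
    simp only [Finset.mem_insert, Finset.mem_singleton, not_or] at hl
    obtain ⟨h1, h2, h3, h4⟩ := hl
    refine ⟨_, hπ.isClosing_sub s j l, ?_⟩
    have e1 : chordIndicator π j j = 1 := by simp [chordIndicator, (hπ.ne_self j).symm]
    have e2 : chordIndicator π j k = 0 := by
      have : k ≠ π j := fun h => hjk' (by rw [h, hπ.invol])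
      simp [chordIndicator, Ne.symm hjk, this]
    have e3 : chordIndicator π l j = 0 := by
      have : j ≠ π l := fun h => h2 (by rw [h, hπ.invol])
      simp [chordIndicator, Ne.symm h1, this]
    have e4 : chordIndicator π l k = 0 := by
      have : k ≠ π l := fun h => h4 (by rw [h, hπ.invol])
      simp [chordIndicator, Ne.symm h3, this]
    simpa [e1, e2, e3, e4] using hc l
  avoids i d hd1 hd2 := by
    by_contra! hcon
    set w : ZMod n := i + 1 + (d : ZMod n) with hw
    set ℓ : ZMod n → ℤ := fun k => lineForm s i d (chordIndicator π k) with hℓdef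
    have hlin : ∀ k l, chordTurn π s l * ℓ k = chordTurn π s k * ℓ l := by
      intro k l
      have h := hcon _ (hπ.isClosing_sub s k l)
      have e : lineForm s i d (fun j => chordTurn π s l * chordIndicator π k j -
          chordTurn π s k * chordIndicator π l j) =
            chordTurn π s l * ℓ k - chordTurn π s k * ℓ l := by
        simp only [hℓdef, lineForm, Finset.mul_sum, ← Finset.sum_sub_distrib]
        exact Finset.sum_congr rfl fun t _ => by ring
      rw [e] at h
      linarith
    have hℓ : ∀ k, k ≠ w → k ≠ π w → ℓ k = (if k ∈ arc i d then turn s k else 0) +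
        (if π k ∈ arc i d then turn s (π k) else 0) := by
      intro k h1 h2
      have h3 : w ≠ π k := fun h => h2 (by rw [h, hπ.invol])
      have h0 : chordIndicator π k w = 0 := by simp [chordIndicator, Ne.symm h1, h3]
      simp only [hℓdef]
      rw [lineForm_eq_sum_arc s i (by omega), sum_mul_chordIndicator, ← hw, h0, mul_zero, add_zero]
    -- The first vertex of the arc serves, unless the chord of `w` ends there; then the second does,
    -- which lies in the arc because a chord is not a cycle edge. Outside the arc, `i` and `i - 1`
    -- play the same roles for `q`.
    obtain ⟨p, hp, hpw, hpw'⟩ : ∃ p ∈ arc i d, p ≠ w ∧ p ≠ π w := by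
      have hne : ∀ p ∈ arc i d, p ≠ w := fun p hp h => add_notMem_arc i (by omega) (h ▸ hp)
      by_cases h : i + 1 = π w
      · have h2 : 2 ≤ d := by
          by_contra h'
          have : d = 1 := by omega
          subst this
          apply hπ.ne_pred w
          rw [← h, hw]; push_cast; ring
        refine ⟨i + 1 + 1, succ_succ_mem_arc i h2, hne _ (succ_succ_mem_arc i h2), fun h' => ?_⟩
        rw [← h] at h'
        have : Fact (1 < n) := ⟨by omega⟩
        simp at h'
      · exact ⟨_, succ_mem_arc i hd1, hne _ (succ_mem_arc i hd1), h⟩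
    obtain ⟨q, hq, hqw, hqw'⟩ : ∃ q ∉ arc i d, q ≠ w ∧ q ≠ π w := by
      have hiw : i ≠ w := by
        intro h
        have h' : i + 1 + ((n - 1 : ℕ) : ZMod n) = i + 1 + d := by
          rw [← self_eq_add_natCast i (by omega)]; exact h
        have := natCast_injOn_lt (by omega) (by omega) (add_left_cancel h')
        omega
      by_cases h : i = π w
      · refine ⟨i - 1, pred_notMem_arc i hd2, fun h' => ?_, fun h' => ?_⟩
        · exact hπ.ne_succ w (by rw [← h, ← h']; ring)
        · rw [← h] at h'
          have : Fact (1 < n) := ⟨by omega⟩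
          simp at h'
      · exact ⟨i, self_notMem_arc i (by omega), hiw, h⟩
    obtain ⟨r, hr⟩ := exists_ratio_of_proportional ha hc hp hpw hpw' hq hqw hqw' hlin hℓ
    exact H i d hd1 hd2 r hr

end Criterion

/-! ### Ratio and sign conditions that force generic slopes. -/

section Sufficient

variable {n : ℕ}

lemma chordTurn_apply_chord {π : ZMod n → ZMod n} (hπ : IsChordPairing π) (s : ZMod n → ℤ)
    (k : ZMod n) : chordTurn π s (π k) = chordTurn π s k := by
  simp only [chordTurn, hπ.invol]
  ring

/-- Slopes are generic if at any vertex `w` two chords not ending in `w` have different ratios. -/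
theorem IsChordPairing.isGenericSlopes_of_ratio_ne [NeZero n] {π : ZMod n → ZMod n}
    (hπ : IsChordPairing π) (hn : 5 ≤ n) {s : ZMod n → ℤ}
    (hs : ∀ k, s k = -1 ∨ s k = 0 ∨ s k = 1)
    (ha : ∀ k, turn s k ≠ 0) (hc : ∀ k, chordTurn π s k ≠ 0)
    (H : ∀ w, ∃ k l, k ≠ w ∧ k ≠ π w ∧ l ≠ w ∧ l ≠ π w ∧
      turn s k * turn s (π k) * chordTurn π s l ^ 2 ≠
        turn s l * turn s (π l) * chordTurn π s k ^ 2) :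
    IsGenericSlopes π s := by
  refine hπ.isGenericSlopes hn hs ha hc fun i d _ _ r hr => ?_
  obtain ⟨k, l, hk, hk', hl, hl', hne⟩ := H (i + 1 + d)
  -- The end in the arc carries the fraction `r` of the chord turn and the other end `1 - r`; the
  -- product does not depend on which end is which.
  have key : ∀ k, k ≠ i + 1 + (d : ZMod n) → k ≠ π (i + 1 + (d : ZMod n)) →
      (turn s k * turn s (π k) : ℚ) = r * (1 - r) * chordTurn π s k ^ 2 := by
    intro k h1 h2
    obtain ⟨h3, h4⟩ := hr k h1 h2
    have hsum : (chordTurn π s k : ℚ) = turn s k + turn s (π k) := by simp [chordTurn]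
    by_cases hkA : k ∈ arc i d
    · have e := h4 hkA
      have e' : (turn s (π k) : ℚ) = (1 - r) * chordTurn π s k := by linear_combination -hsum - e
      rw [e, e']; ring
    · have hk'A : π k ∈ arc i d := by
        by_contra h
        exact hkA (h3.2 h)
      have e := (hr (π k) (fun h => h2 (hπ.eq_iff.1 h))
        (fun h => h1 (by rw [← hπ.invol k, h, hπ.invol]))).2 hk'A
      rw [chordTurn_apply_chord hπ] at e
      have e' : (turn s k : ℚ) = (1 - r) * chordTurn π s k := by linear_combination -hsum - e
      rw [e, e']; ring
  apply hne
  have h1 := key k hk hk'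
  have h2 := key l hl hl'
  have : (turn s k * turn s (π k) * chordTurn π s l ^ 2 : ℚ) =
      turn s l * turn s (π l) * chordTurn π s k ^ 2 := by rw [h1, h2]; ring
  exact_mod_cast this

lemma sum_turn [NeZero n] (s : ZMod n → ℤ) : ∑ k, turn s k = 0 := by
  have := sum_turn_mul s (fun _ => (1 : ℤ))
  simpa using this

/-- The chords with different turns at their two ends come in an even number. -/
lemma IsChordPairing.exists_other_turn_ne [NeZero n] {π : ZMod n → ZMod n} (hπ : IsChordPairing π)
    {s σ : ZMod n → ℤ} (hσ : ∀ k, σ k = 1 ∨ σ k = -1) (hσπ : ∀ k, σ (π k) = σ k)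
    (hmod : ∀ k, turn s k = σ k ∨ turn s k = -2 * σ k) {h : ZMod n} (hh : turn s h ≠ turn s (π h))
    (w : ZMod n) : ∃ k, k ≠ w ∧ k ≠ π w ∧ turn s k ≠ turn s (π k) := by
  by_contra! hcon
  have hw : h = w ∨ h = π w := by
    by_contra! h'
    exact hh (hcon h h'.1 h'.2)
  have hw' : turn s w ≠ turn s (π w) := by
    rcases hw with rfl | rfl
    · exact hh
    · rw [hπ.invol] at hh
      exact hh.symm
  have hsum : ∑ k, (turn s k : ZMod 2) = 0 := by
    exact_mod_cast congrArg (Int.cast : ℤ → ZMod 2) (sum_turn s)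
  have hsub : ∑ k ∈ Finset.univ \ {w, π w}, (turn s k : ZMod 2) = 0 := by
    refine Finset.sum_involution (fun k _ => π k) ?_ ?_ ?_ ?_
    · intro k hk
      simp only [Finset.mem_sdiff, Finset.mem_univ, true_and, Finset.mem_insert,
        Finset.mem_singleton, not_or] at hk
      rw [hcon k hk.1 hk.2]
      exact CharTwo.add_self_eq_zero _
    · intro k _ _
      exact hπ.ne_self k
    · intro k hk
      simp only [Finset.mem_sdiff, Finset.mem_univ, true_and, Finset.mem_insert,
        Finset.mem_singleton, not_or] at hk ⊢
      exact ⟨fun h' => hk.2 (hπ.eq_iff.1 h'), fun h' => hk.1 (by rw [← hπ.invol k, h', hπ.invol])⟩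
    · intro k _
      exact hπ.invol k
  rw [← Finset.sum_sdiff (Finset.subset_univ {w, π w}), hsub, zero_add,
    Finset.sum_pair (hπ.ne_self w).symm] at hsum
  have h1 := hmod w
  have h2 := hmod (π w)
  rw [hσπ] at h2
  -- The turns at this chord are `σ w` and `-2 * σ w` in some order, with odd sum, while equal turns
  -- on all other chords make it even.
  have hodd : ((turn s w + turn s (π w) : ℤ) : ZMod 2) = 0 := by push_cast; exact hsum
  rw [ZMod.intCast_zmod_eq_zero_iff_dvd] at hodd
  rcases hσ w with h | h <;> rw [h] at h1 h2 <;> omega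

/-- If the turns are congruent modulo three to signs which agree along chords, with nonzero total,
and some chord has different turns at its ends, then the slopes are generic. -/
theorem IsChordPairing.isGenericSlopes_of_sign [NeZero n] {π : ZMod n → ZMod n}
    (hπ : IsChordPairing π) (hn : 5 ≤ n) {s σ : ZMod n → ℤ}
    (hs : ∀ k, s k = -1 ∨ s k = 0 ∨ s k = 1)
    (hσ : ∀ k, σ k = 1 ∨ σ k = -1) (hσπ : ∀ k, σ (π k) = σ k)
    (hmod : ∀ k, turn s k = σ k ∨ turn s k = -2 * σ k) (hsum : ∑ k, σ k ≠ 0)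
    {h : ZMod n} (hh : turn s h ≠ turn s (π h)) : IsGenericSlopes π s := by
  have hmod' : ∀ k, turn s (π k) = σ k ∨ turn s (π k) = -2 * σ k := fun k => by
    rw [← hσπ k]; exact hmod (π k)
  refine hπ.isGenericSlopes hn hs (fun k => ?_) (fun k => ?_) fun i d hd1 hd2 r hr => ?_
  · have := hmod k
    rcases hσ k with h | h <;> rw [h] at this <;> omega
  · have h1 := hmod k
    have h2 := hmod' k
    rw [chordTurn]
    rcases hσ k with h | h <;> rw [h] at h1 h2 <;> omega
  set w : ZMod n := i + 1 + (d : ZMod n) with hw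
  set A := arc i d with hA
  have hwA : w ∉ A := add_notMem_arc i (by omega)
  have hswap : ∀ k, k ≠ w → k ≠ π w → π k ≠ w ∧ π k ≠ π w := fun k h1 h2 =>
    ⟨fun h' => h2 (hπ.eq_iff.1 h'), fun h' => h1 (by rw [← hπ.invol k, h', hπ.invol])⟩
  -- Turns `σ` and `-2σ` add up to `-σ`, so the end in the arc carries the fraction -1 or 2.
  have hratio : r = 2 ∨ r = -1 := by
    obtain ⟨k, hk1, hk2, hk⟩ := hπ.exists_other_turn_ne hσ hσπ hmod hh w
    obtain ⟨k, hk1, hk2, hk, hkA⟩ : ∃ k, k ≠ w ∧ k ≠ π w ∧ turn s k ≠ turn s (π k) ∧ k ∈ A := by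
      by_cases hkA : k ∈ A
      · exact ⟨k, hk1, hk2, hk, hkA⟩
      · refine ⟨π k, (hswap k hk1 hk2).1, (hswap k hk1 hk2).2, ?_, ?_⟩
        · rw [hπ.invol]; exact hk.symm
        · by_contra h'
          exact hkA ((hr k hk1 hk2).1.2 h')
    have e := (hr k hk1 hk2).2 hkA
    simp only [chordTurn] at e
    rcases hmod k with h1 | h1 <;> rcases hmod' k with h2 | h2
    · exact absurd (h1.trans h2.symm) hk
    · rw [h1, h2] at e
      rcases hσ k with h3 | h3 <;> rw [h3] at e <;> push_cast at e <;> right <;> linarith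
    · rw [h1, h2] at e
      rcases hσ k with h3 | h3 <;> rw [h3] at e <;> push_cast at e <;> left <;> linarith
    · exact absurd (h1.trans h2.symm) hk
  set U : Finset (ZMod n) := Finset.univ \ {w, π w} with hU
  have hUmem : ∀ k, k ∈ U ↔ k ≠ w ∧ k ≠ π w := fun k => by simp [hU]
  set X := ∑ k ∈ U.filter (· ∈ A), σ k with hX
  have hX' : ∑ k ∈ U.filter (· ∉ A), σ k = X := by
    refine Finset.sum_nbij' π π ?_ ?_ (fun k _ => hπ.invol k) (fun k _ => hπ.invol k)
      (fun k _ => (hσπ k).symm)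
    · intro k hk
      rw [Finset.mem_filter, hUmem] at hk ⊢
      refine ⟨hswap k hk.1.1 hk.1.2, ?_⟩
      by_contra h'
      exact hk.2 ((hr k hk.1.1 hk.1.2).1.2 h')
    · intro k hk
      rw [Finset.mem_filter, hUmem] at hk ⊢
      exact ⟨hswap k hk.1.1 hk.1.2, (hr k hk.1.1 hk.1.2).1.1 hk.2⟩
  have hsplit : ∀ g : ZMod n → ℤ, ∑ k, g k =
      ∑ k ∈ U.filter (· ∈ A), g k + ∑ k ∈ U.filter (· ∉ A), g k + (g w + g (π w)) := by
    intro g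
    rw [Finset.sum_filter_add_sum_filter_not, ← Finset.sum_pair (hπ.ne_self w).symm, hU,
      Finset.sum_sdiff (Finset.subset_univ _)]
  have hsA : ∑ k ∈ A, turn s k =
      ∑ k ∈ U.filter (· ∈ A), turn s k + if π w ∈ A then turn s (π w) else 0 := by
    have h1 := Finset.sum_filter_add_sum_filter_not A (· ≠ π w) (turn s)
    have h2 : A.filter (· ≠ π w) = U.filter (· ∈ A) := by
      ext k
      simp only [Finset.mem_filter, hUmem]
      exact ⟨fun h => ⟨⟨fun h' => hwA (h' ▸ h.1), h.2⟩, h.1⟩, fun h => ⟨h.2, h.1.2⟩⟩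
    rw [← h1, h2]
    congr 1
    simp only [ne_eq, not_not, Finset.sum_filter, Finset.sum_ite_eq']
  have hσsum := hsplit σ
  have hasum := hsplit (turn s)
  rw [sum_turn] at hasum
  rw [hX', ← hX, hσπ] at hσsum
  have harc : ∑ k ∈ A, turn s k = s i - s (i + d) := sum_arc_turn s i (by omega)
  have hturnw : turn s w = s (i + d) - s w := by
    rw [turn, hw]; congr 2; ring
  have b1 := hs i
  have b2 := hs (i + d)
  have b3 := hs w
  have m1 := hmod w
  have m2 := hmod' w
  have m3 := hσ w
  rcases hratio with rfl | rfl
  · have t1 : ∑ k ∈ U.filter (· ∈ A), turn s k = -2 * X := by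
      rw [hX, Finset.mul_sum]
      refine Finset.sum_congr rfl fun k hk => ?_
      rw [Finset.mem_filter, hUmem] at hk
      have e := (hr k hk.1.1 hk.1.2).2 hk.2
      simp only [chordTurn] at e
      have e' : turn s k = 2 * (turn s k + turn s (π k)) := by exact_mod_cast e
      have h1 := hmod k
      have h2 := hmod' k
      rcases hσ k with h3 | h3 <;> rw [h3] at h1 h2 ⊢ <;> omega
    have t2 : ∑ k ∈ U.filter (· ∉ A), turn s k = X := by
      rw [← hX']
      refine Finset.sum_congr rfl fun k hk => ?_
      rw [Finset.mem_filter, hUmem] at hk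
      have hk' := hswap k hk.1.1 hk.1.2
      have e := (hr (π k) hk'.1 hk'.2).2 (by
        by_contra h'
        exact hk.2 ((hr k hk.1.1 hk.1.2).1.2 h'))
      simp only [chordTurn, hπ.invol] at e
      have e' : turn s (π k) = 2 * (turn s (π k) + turn s k) := by exact_mod_cast e
      have h1 := hmod k
      have h2 := hmod' k
      rcases hσ k with h3 | h3 <;> rw [h3] at h1 h2 ⊢ <;> omega
    rw [t1, t2] at hasum
    rw [t1, harc] at hsA
    -- `X` equals `turn s w + turn s (π w)`, that is `2σ`, `-σ` or `-4σ` with `σ = σ w`. The value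
    -- `-σ` makes the total sign zero; the others make the arc sum exceed 2 in absolute value,
    -- impossible for a difference of two slopes.
    split_ifs at hsA <;> rcases m3 with m3 | m3 <;> rw [m3] at m1 m2 hσsum <;> omega
  · have t1 : ∑ k ∈ U.filter (· ∈ A), turn s k = X := by
      rw [hX]
      refine Finset.sum_congr rfl fun k hk => ?_
      rw [Finset.mem_filter, hUmem] at hk
      have e := (hr k hk.1.1 hk.1.2).2 hk.2
      simp only [chordTurn] at e
      have e' : turn s k = -1 * (turn s k + turn s (π k)) := by exact_mod_cast e
      have h1 := hmod k
      have h2 := hmod' k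
      rcases hσ k with h3 | h3 <;> rw [h3] at h1 h2 ⊢ <;> omega
    have t2 : ∑ k ∈ U.filter (· ∉ A), turn s k = -2 * X := by
      rw [← hX', Finset.mul_sum]
      refine Finset.sum_congr rfl fun k hk => ?_
      rw [Finset.mem_filter, hUmem] at hk
      have hk' := hswap k hk.1.1 hk.1.2
      have e := (hr (π k) hk'.1 hk'.2).2 (by
        by_contra h'
        exact hk.2 ((hr k hk.1.1 hk.1.2).1.2 h'))
      simp only [chordTurn, hπ.invol] at e
      have e' : turn s (π k) = -1 * (turn s (π k) + turn s k) := by exact_mod_cast e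
      have h1 := hmod k
      have h2 := hmod' k
      rcases hσ k with h3 | h3 <;> rw [h3] at h1 h2 ⊢ <;> omega
    rw [t1, t2] at hasum
    rw [t1, harc] at hsA
    -- As before, except that `X = 2σ` with `π w` off the arc gives arc sum `2σ`. Then `s (i + d) =
    -- -σ`, and turn `σ` at `w` would need `s w = -2σ`.
    split_ifs at hsA <;> rcases m3 with m3 | m3 <;> rw [m3] at m1 m2 hσsum <;> omega

end Sufficient

/-! ### Slopes modulo three built from signs on the chords. -/

section Signs

variable {n : ℕ}

lemma valMinAbs_three_mem (u : ZMod 3) :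
    u.valMinAbs = -1 ∨ u.valMinAbs = 0 ∨ u.valMinAbs = 1 := by
  revert u; decide

/-- Among the representatives -1, 0, 1, adding `e` either moves by `e` or wraps from one extreme to
the other; it wraps exactly at `u = e`. -/
lemma valMinAbs_three_sub {e : ℤ} (he : e = 1 ∨ e = -1) (u : ZMod 3) :
    (u + (e : ZMod 3)).valMinAbs - u.valMinAbs = e ∨
      (u + (e : ZMod 3)).valMinAbs - u.valMinAbs = -2 * e := by
  rcases he with rfl | rfl <;> revert u <;> decide

lemma valMinAbs_three_sub_eq_iff {e : ℤ} (he : e = 1 ∨ e = -1) (u : ZMod 3) :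
    (u + (e : ZMod 3)).valMinAbs - u.valMinAbs = -2 * e ↔ u = e := by
  rcases he with rfl | rfl <;> revert u <;> decide

/-- Signs on the chords whose total is a nonzero multiple of three yield generic slopes, if their
sum between the ends of some chord is not a multiple of three. -/
theorem IsChordPairing.exists_isGenericSlopes_of_sign [NeZero n] {π : ZMod n → ZMod n}
    (hπ : IsChordPairing π) (hn : 5 ≤ n) {σ : ZMod n → ℤ}
    (hσ : ∀ k, σ k = 1 ∨ σ k = -1) (hσπ : ∀ k, σ (π k) = σ k)
    (hsum : ∑ k, σ k ≠ 0) (hdvd : (3 : ℤ) ∣ ∑ k, σ k) {h : ZMod n} {d : ℕ} (hd : π h = h + d)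
    (hh : ¬ (3 : ℤ) ∣ ∑ t ∈ Finset.range d, σ (h + 1 + t)) :
    ∃ s, IsGenericSlopes π s := by
  obtain ⟨q, hq⟩ := exists_primitive (fun k => -(σ (k + 1) : ZMod 3)) (by
    rw [Finset.sum_neg_distrib, neg_eq_zero]
    have h1 := Equiv.sum_comp (Equiv.addRight (1 : ZMod n)) (fun k => (σ k : ZMod 3))
    simp only [Equiv.coe_addRight] at h1
    rw [h1]
    have h2 := (ZMod.intCast_zmod_eq_zero_iff_dvd (∑ k, σ k) 3).2 hdvd
    exact_mod_cast h2)
  have hqne : q (π h) ≠ q h := by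
    intro h'
    have h1 := sum_range_sub_add q h d
    rw [← hd, h', sub_self] at h1
    apply hh
    refine (ZMod.intCast_zmod_eq_zero_iff_dvd _ 3).1 ?_
    rw [Int.cast_sum, ← neg_eq_zero,
      ← Finset.sum_neg_distrib, ← h1]
    refine Finset.sum_congr rfl fun t _ => ?_
    rw [hq, add_right_comm]
  -- The slopes modulo three are free up to a constant; this one makes the residue wrap at `h`. It
  -- would wrap at `π h` as well only if `q (π h) = q h`.
  let r : ZMod 3 := σ h - q h
  let s : ZMod n → ℤ := fun k => (q k + r).valMinAbs
  have hturn : ∀ k, turn s k =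
      (q k + r + (σ k : ZMod 3)).valMinAbs - (q k + r).valMinAbs := by
    intro k
    have h1 := hq (k - 1)
    rw [sub_add_cancel] at h1
    have h2 : q (k - 1) + r = q k + r + σ k := by linear_combination -h1
    simp only [turn, s, h2]
  refine ⟨s, hπ.isGenericSlopes_of_sign hn (fun k => valMinAbs_three_mem _) hσ hσπ
    (fun k => ?_) hsum (h := h) ?_⟩
  · rw [hturn]
    exact valMinAbs_three_sub (hσ k) _
  · have e1 : turn s h = -2 * σ h := by
      rw [hturn, valMinAbs_three_sub_eq_iff (hσ h)]
      simp [r]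
    have e2 : turn s (π h) ≠ -2 * σ h := by
      rw [hturn, hσπ, Ne, valMinAbs_three_sub_eq_iff (hσ h)]
      intro h'
      apply hqne
      simp only [r] at h'
      linear_combination h'
    rw [e1]
    exact e2.symm

lemma sum_sign_eq (S F : Finset (ZMod n)) :
    ∑ k ∈ S, (if k ∈ F then (-1 : ℤ) else 1) = S.card - 2 * (S ∩ F).card := by
  have h : ∀ k, (if k ∈ F then (-1 : ℤ) else 1) = 1 - 2 * (if k ∈ F then 1 else 0) := by
    intro k; split_ifs <;> norm_num
  simp only [h, Finset.sum_sub_distrib, ← Finset.mul_sum, Finset.sum_boole]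
  simp [Finset.filter_mem_eq_inter]

lemma card_arc (i : ZMod n) {d : ℕ} (hd : d ≤ n) : (arc i d).card = d := by
  have := sum_arc i hd (fun _ => 1)
  simpa using this

lemma IsChordPairing.exists_isGenericSlopes_of_finset [NeZero n] {π : ZMod n → ZMod n}
    (hπ : IsChordPairing π) (hn : 5 ≤ n) {F : Finset (ZMod n)} (hF : ∀ k ∈ F, π k ∈ F)
    (hne : (n : ℤ) - 2 * F.card ≠ 0) (hdvd : (3 : ℤ) ∣ n - 2 * F.card) {h : ZMod n} {d : ℕ}
    (hdn : d ≤ n) (hd : π h = h + d) (hh : ¬ (3 : ℤ) ∣ d - 2 * (arc h d ∩ F).card) :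
    ∃ s, IsGenericSlopes π s := by
  have htot : ∑ k, (if k ∈ F then (-1 : ℤ) else 1) = n - 2 * F.card := by
    rw [sum_sign_eq, Finset.card_univ, ZMod.card, Finset.univ_inter]
  refine hπ.exists_isGenericSlopes_of_sign hn (σ := fun k => if k ∈ F then -1 else 1)
    (fun k => by split_ifs <;> simp) (fun k => ?_) (by rw [htot]; exact hne)
    (by rw [htot]; exact hdvd) hd ?_
  · have : π k ∈ F ↔ k ∈ F := ⟨fun h => by simpa [hπ.invol] using hF _ h, hF k⟩
    simp only [this]
  · rw [← sum_arc h hdn (fun k => if k ∈ F then (-1 : ℤ) else 1), sum_sign_eq, card_arc h hdn]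
    exact hh

/-- A set closed under `π` can be avoided by sets closed under `π` of any suitable size. -/
lemma IsChordPairing.exists_closed_disjoint [NeZero n] {π : ZMod n → ZMod n}
    (hπ : IsChordPairing π) (S : Finset (ZMod n)) (hS : ∀ k ∈ S, π k ∈ S) (j : ℕ)
    (hj : S.card + 2 * j ≤ n) :
    ∃ F : Finset (ZMod n), (∀ k ∈ F, π k ∈ F) ∧ Disjoint S F ∧ F.card = 2 * j := by
  induction j with
  | zero => exact ⟨∅, by simp, by simp, by simp⟩
  | succ j ih =>
    obtain ⟨F, hF, hSF, hcard⟩ := ih (by omega)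
    obtain ⟨g, hg⟩ : ∃ g, g ∉ S ∪ F := by
      by_contra! h
      have h2 := Finset.card_le_card (fun k _ => h k : (Finset.univ : Finset (ZMod n)) ⊆ S ∪ F)
      rw [Finset.card_univ, ZMod.card] at h2
      have := Finset.card_union_le S F
      omega
    rw [Finset.mem_union, not_or] at hg
    have hg' : π g ∉ S ∧ π g ∉ F :=
      ⟨fun h => hg.1 (by simpa [hπ.invol] using hS _ h),
        fun h => hg.2 (by simpa [hπ.invol] using hF _ h)⟩
    refine ⟨insert g (insert (π g) F), ?_, ?_, ?_⟩
    · intro k hk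
      simp only [Finset.mem_insert] at hk ⊢
      rcases hk with rfl | rfl | hk
      · simp
      · simp [hπ.invol]
      · exact Or.inr (Or.inr (hF k hk))
    · simp only [Finset.disjoint_insert_right]
      exact ⟨hg.1, hg'.1, hSF⟩
    · rw [Finset.card_insert_of_notMem, Finset.card_insert_of_notMem hg'.2, hcard]
      · ring
      · simp [hg.2, (hπ.ne_self g).symm]

/-- If some chord does not halve the cycle, generic slopes exist as soon as the total of the signs
can be made a nonzero multiple of three by negative signs on `j + 1` chords. -/
theorem IsChordPairing.exists_isGenericSlopes_of_not_antipodal [NeZero n] {π : ZMod n → ZMod n}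
    (hπ : IsChordPairing π) {j : ℕ} (hj : 4 + 2 * j ≤ n) (hn : 5 ≤ n)
    (hne : (n : ℤ) - 4 * (j + 1) ≠ 0) (hdvd : (3 : ℤ) ∣ n - 4 * (j + 1))
    {h : ZMod n} (hh : ∀ d : ℕ, 2 * d = n → π h ≠ h + d) : ∃ s, IsGenericSlopes π s := by
  set d := (π h - h).val with hd
  have hdn : d < n := ZMod.val_lt _
  have hπh : π h = h + d := by rw [hd, ZMod.natCast_zmod_val]; ring
  have hd1 : 1 ≤ d := by
    by_contra h'
    have : d = 0 := by omega
    rw [this] at hπh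
    exact hπ.ne_self h (by simpa using hπh)
  set I := arc h d with hI
  have hhI : h ∉ I := self_notMem_arc h (by omega)
  have hπhI : π h ∈ I := by
    have : π h = h + 1 + ((d - 1 : ℕ) : ZMod n) := by
      rw [hπh, Nat.cast_sub hd1]; push_cast; ring
    rw [this, add_natCast_mem_arc_iff h (by omega) (by omega)]
    omega
  have hIcard : I.card = d := card_arc h hdn.le
  -- Otherwise `π` would exchange the arc with its complement, and the arc would be half the cycle.
  obtain ⟨e, he⟩ : ∃ e, ¬ (e ∈ I ↔ π e ∉ I) := by
    by_contra! hcon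
    have h1 : I.card = Iᶜ.card := by
      refine Finset.card_nbij' π π ?_ ?_ (fun k _ => hπ.invol k) (fun k _ => hπ.invol k)
      · intro k hk
        simpa using (hcon k).1 hk
      · intro k hk
        have := hcon (π k)
        rw [hπ.invol] at this
        exact this.2 (by simpa using hk)
    rw [Finset.card_compl, ZMod.card, hIcard] at h1
    exact hh d (by omega) hπh
  have heh : e ≠ h := by
    rintro rfl
    exact he (by simp [hhI, hπhI])
  have heh' : e ≠ π h := by
    rintro rfl
    exact he (by simp [hhI, hπhI, hπ.invol])
  have hpair : ∀ k, k ≠ π k := fun k => (hπ.ne_self k).symm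
  obtain ⟨F, hF, hSF, hcard⟩ := hπ.exists_closed_disjoint ({h, π h, e, π e} : Finset (ZMod n))
    (by
      intro k hk
      simp only [Finset.mem_insert, Finset.mem_singleton] at hk ⊢
      rcases hk with rfl | rfl | rfl | rfl <;> simp [hπ.invol]) j
    (by have := Finset.card_le_four (a := h) (b := π h) (c := e) (d := π e); omega)
  simp only [Finset.disjoint_insert_left, Finset.disjoint_singleton_left] at hSF
  obtain ⟨n1, n2, n3, n4⟩ := hSF
  have hclosed : ∀ g, ∀ k ∈ insert g (insert (π g) F), π k ∈ insert g (insert (π g) F) := by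
    intro g k hk
    simp only [Finset.mem_insert] at hk ⊢
    rcases hk with rfl | rfl | hk
    · simp
    · simp [hπ.invol]
    · exact Or.inr (Or.inr (hF k hk))
  have hcard' : ∀ g, g ∉ F → π g ∉ F → (insert g (insert (π g) F)).card = 2 * j + 2 := by
    intro g hg hg'
    rw [Finset.card_insert_of_notMem, Finset.card_insert_of_notMem hg', hcard]
    simp [hg, hpair g]
  have hcount : ∀ g, g ∉ F → π g ∉ F → (I ∩ insert g (insert (π g) F)).card =
      (if g ∈ I then 1 else 0) + (if π g ∈ I then 1 else 0) + (I ∩ F).card := by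
    intro g hg hg'
    have e1 : π g ∉ I ∩ F := fun h' => hg' (Finset.mem_inter.1 h').2
    have e2 : g ∉ insert (π g) (I ∩ F) := by simp [hg, hpair g]
    have e3 : g ∉ I ∩ F := fun h' => hg (Finset.mem_inter.1 h').2
    by_cases h1 : g ∈ I <;> by_cases h2 : π g ∈ I
    · rw [Finset.inter_insert_of_mem h1, Finset.inter_insert_of_mem h2,
        Finset.card_insert_of_notMem e2, Finset.card_insert_of_notMem e1]
      simp [h1, h2]; ring
    · rw [Finset.inter_insert_of_mem h1, Finset.inter_insert_of_notMem h2,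
        Finset.card_insert_of_notMem e3]
      simp [h1, h2]; ring
    · rw [Finset.inter_insert_of_notMem h1, Finset.inter_insert_of_mem h2,
        Finset.card_insert_of_notMem e1]
      simp [h1, h2]; ring
    · rw [Finset.inter_insert_of_notMem h1, Finset.inter_insert_of_notMem h2]
      simp [h1, h2]
  have main : ∀ g, g ∉ F → π g ∉ F →
      ¬ (3 : ℤ) ∣ d - 2 * (I ∩ insert g (insert (π g) F)).card → ∃ s, IsGenericSlopes π s := by
    intro g hg hg' h3
    refine hπ.exists_isGenericSlopes_of_finset hn (hclosed g) ?_ ?_ hdn.le hπh h3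
    · rw [hcard' g hg hg']; push_cast; intro h'; apply hne; linarith
    · rw [hcard' g hg hg']; push_cast
      have : (n : ℤ) - 2 * (2 * j + 2) = n - 4 * (j + 1) := by ring
      rwa [this]
  -- The chord of `h` has one end in `I`, that of `e` none or two. Making one or the other negative
  -- gives sums differing by 2, so not both are multiples of three.
  by_cases h3 : (3 : ℤ) ∣ d - 2 * (I ∩ insert h (insert (π h) F)).card
  · refine main e n3 n4 fun h4 => ?_
    rw [hcount h n1 n2, if_neg hhI, if_pos hπhI] at h3
    rw [hcount e n3 n4] at h4
    by_cases h1 : e ∈ I <;> by_cases h2 : π e ∈ I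
    · simp only [h1, h2, if_true] at h4
      push_cast at h3 h4
      omega
    · exact he (by simp [h1, h2])
    · exact he (by simp [h1, h2])
    · simp only [h1, h2, if_false] at h4
      push_cast at h3 h4
      omega
  · exact main h n1 n2 h3

end Signs

/-! ### Short cycles -/

section Small

/-- `P` holds for all lists of chords that extend `acc` by `m` chords between the vertices `rem`
with ends related by `Q`. -/
def AllPairings (Q : ℕ → ℕ → Prop) (P : List (ℕ × ℕ) → Prop) :
    ℕ → List ℕ → List (ℕ × ℕ) → Prop
  | 0, _, acc => P acc
  -- A default never reached when `rem` has `2 * m` elements.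
  | _ + 1, [], _ => True
  | m + 1, a :: rem, acc => ∀ b ∈ rem, Q a b → AllPairings Q P m (rem.erase b) ((a, b) :: acc)

instance decidableAllPairings (Q : ℕ → ℕ → Prop) [∀ a b, Decidable (Q a b)]
    (P : List (ℕ × ℕ) → Prop) [DecidablePred P] :
    ∀ m rem acc, Decidable (AllPairings Q P m rem acc)
  | 0, _, acc => inferInstanceAs (Decidable (P acc))
  | _ + 1, [], _ => inferInstanceAs (Decidable True)
  | m + 1, a :: rem, acc =>
    have := decidableAllPairings Q P m
    inferInstanceAs
      (Decidable (∀ b ∈ rem, Q a b → AllPairings Q P m (rem.erase b) ((a, b) :: acc)))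

lemma IsChordPairing.val_eq_iff {n : ℕ} [NeZero n] {π : ZMod n → ZMod n} (hπ : IsChordPairing π)
    {a b : ℕ} (ha : a < n) (hb : b < n) : (π a).val = b ↔ (π b).val = a := by
  have hval : ∀ (k : ZMod n) (t : ℕ), t < n → (k.val = t ↔ k = t) := fun a t ht =>
    ⟨fun h => by rw [← h, ZMod.natCast_zmod_val], fun h => by rw [h, ZMod.val_cast_of_lt ht]⟩
  rw [hval _ b hb, hval _ a ha, hπ.eq_iff, eq_comm]

/-- At each level, follow the branch that joins the head to its partner under `π`; the leaf reached
lists the chords. -/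
lemma IsChordPairing.exists_of_allPairings {n : ℕ} [NeZero n] {π : ZMod n → ZMod n}
    (hπ : IsChordPairing π) {Q : ℕ → ℕ → Prop} (hQ : ∀ t < n, Q t (π t).val)
    {P : List (ℕ × ℕ) → Prop} : ∀ (m : ℕ) (rem : List ℕ) (acc : List (ℕ × ℕ)),
      rem.length = 2 * m → rem.Nodup → (∀ k ∈ rem, k < n ∧ (π k).val ∈ rem) →
      (∀ e ∈ acc, e.1 < n ∧ (π e.1).val = e.2) →
      (∀ k < n, k ∈ rem ∨ ∃ e ∈ acc, k = e.1 ∨ k = e.2) →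
      AllPairings Q P m rem acc →
      ∃ L : List (ℕ × ℕ), P L ∧ (∀ e ∈ L, e.1 < n ∧ (π e.1).val = e.2) ∧
        ∀ k < n, ∃ e ∈ L, k = e.1 ∨ k = e.2
  | 0, rem, acc, hlen, _, _, hacc, hcov, h => by
    obtain rfl : rem = [] := List.length_eq_zero_iff.1 (by omega)
    exact ⟨acc, h, hacc, fun k hk => (hcov k hk).resolve_left (by simp)⟩
  | m + 1, [], acc, hlen, _, _, _, _, _ => by simp at hlen
  | m + 1, a :: rem, acc, hlen, hnd, hrem, hacc, hcov, h => by
    obtain ⟨ha, hπa⟩ := hrem a (by simp)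
    rw [List.nodup_cons] at hnd
    have hne : (π a).val ≠ a := fun h' => hπ.ne_self (a : ZMod n) (by
      rw [← ZMod.natCast_zmod_val (π (a : ZMod n)), h'])
    have hb : (π a).val ∈ rem := (List.mem_cons.1 hπa).resolve_left hne
    refine hπ.exists_of_allPairings hQ m (rem.erase (π a).val) ((a, (π a).val) :: acc)
      ?_ (hnd.2.erase _) ?_ ?_ ?_ (h _ hb (hQ a ha))
    · rw [List.length_erase_of_mem hb]
      simp only [List.length_cons] at hlen
      omega
    · intro k hk
      rw [hnd.2.mem_erase_iff] at hk
      obtain ⟨hkn, hk'⟩ := hrem k (List.mem_cons_of_mem _ hk.2)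
      refine ⟨hkn, hnd.2.mem_erase_iff.2 ⟨fun h' => ?_, ?_⟩⟩
      · rw [hπ.val_eq_iff hkn (ZMod.val_lt _), ZMod.natCast_zmod_val, hπ.invol,
          ZMod.val_cast_of_lt ha] at h'
        exact hnd.1 (h' ▸ hk.2)
      · refine (List.mem_cons.1 hk').resolve_left fun h' => ?_
        exact hk.1 ((hπ.val_eq_iff hkn ha).1 h').symm
    · intro e he
      rcases List.mem_cons.1 he with rfl | he
      · exact ⟨ha, rfl⟩
      · exact hacc e he
    · intro k hk
      rcases hcov k hk with h' | ⟨e, he, hke⟩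
      · rcases List.mem_cons.1 h' with rfl | h'
        · exact Or.inr ⟨_, List.mem_cons_self, Or.inl rfl⟩
        · by_cases hkb : k = (π a).val
          · exact Or.inr ⟨_, List.mem_cons_self, Or.inr hkb⟩
          · exact Or.inl (hnd.2.mem_erase_iff.2 ⟨hkb, h'⟩)
      · exact Or.inr ⟨e, List.mem_cons_of_mem _ he, hke⟩

/-- The turns `u` do not cancel along the chords `L`, and omitting any chord leaves two chords
with different ratios. -/
def RatioCondition (u : ℕ → ℤ) (L : List (ℕ × ℕ)) : Prop :=
  (∀ e ∈ L, u e.1 + u e.2 ≠ 0) ∧ ∀ g ∈ L,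
    ∃ e ∈ L, e ≠ g ∧ e ≠ g.swap ∧ ∃ f ∈ L, f ≠ g ∧ f ≠ g.swap ∧
      u e.1 * u e.2 * (u f.1 + u f.2) ^ 2 ≠ u f.1 * u f.2 * (u e.1 + u e.2) ^ 2

instance (u : ℕ → ℤ) (L : List (ℕ × ℕ)) : Decidable (RatioCondition u L) := by
  unfold RatioCondition; infer_instance

/-- The function with period `l.length` given by a list of values. -/
def periodic (l : List ℤ) (t : ℕ) : ℤ := l.getD (t % l.length) 0

lemma IsChordPairing.isGenericSlopes_of_ratioCondition {n : ℕ} [NeZero n] {π : ZMod n → ZMod n}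
    (hπ : IsChordPairing π) (hn : 5 ≤ n) {c : List ℤ} (hlen : c.length = n)
    (hc : ∀ k < n, periodic c k = -1 ∨ periodic c k = 0 ∨ periodic c k = 1)
    (hu : ∀ k < n, periodic c (k + (n - 1)) - periodic c k ≠ 0)
    {L : List (ℕ × ℕ)} (hL : ∀ e ∈ L, e.1 < n ∧ (π e.1).val = e.2)
    (hcov : ∀ k < n, ∃ e ∈ L, k = e.1 ∨ k = e.2)
    (hratio : RatioCondition (fun t => periodic c (t + (n - 1)) - periodic c t) L) :
    IsGenericSlopes π fun k : ZMod n => periodic c k.val := by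
  set s : ZMod n → ℤ := fun k => periodic c k.val with hs
  -- The predecessor is written as `t + (n - 1)` to avoid truncated subtraction at `0`.
  have hturn : ∀ t : ℕ, turn s (t : ZMod n) = periodic c (t + (n - 1)) - periodic c t := by
    intro t
    have h1 : (t : ZMod n) - 1 = ((t + (n - 1) : ℕ) : ZMod n) := by
      rw [Nat.cast_add, Nat.cast_sub (by omega)]
      simp [sub_eq_add_neg]
    have h2 : ∀ t : ℕ, s (t : ZMod n) = periodic c t := fun t => by
      simp only [hs, periodic, ZMod.val_natCast, hlen, Nat.mod_mod]
    rw [turn, h1, h2, h2]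
  have hpair : ∀ e ∈ L, π (e.1 : ZMod n) = (e.2 : ℕ) := fun e he => by
    rw [← (hL e he).2, ZMod.natCast_zmod_val]
  have hcov' : ∀ k : ZMod n, ∃ e ∈ L, k = (e.1 : ℕ) ∨ k = (e.2 : ℕ) := fun k => by
    obtain ⟨e, he, h⟩ := hcov k.val (ZMod.val_lt k)
    refine ⟨e, he, h.imp (fun h => ?_) fun h => ?_⟩ <;> rw [← h, ZMod.natCast_zmod_val]
  have hct : ∀ e ∈ L, chordTurn π s (e.1 : ℕ) =
      (periodic c (e.1 + (n - 1)) - periodic c e.1) +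
        (periodic c (e.2 + (n - 1)) - periodic c e.2) := fun e he => by
    rw [chordTurn, hpair e he, hturn, hturn]
  have hdiff : ∀ e ∈ L, ∀ g ∈ L, e ≠ g → e ≠ g.swap →
      ∀ w : ZMod n, w = (g.1 : ℕ) ∨ w = (g.2 : ℕ) →
      ((e.1 : ℕ) : ZMod n) ≠ w ∧ ((e.1 : ℕ) : ZMod n) ≠ π w := by
    intro e he g hg h1 h2 w hw
    have hval : ∀ {a b : ℕ}, a < n → b < n → (a : ZMod n) = b → a = b := natCast_injOn_lt
    have hg2 : g.2 < n := (hL g hg).2 ▸ ZMod.val_lt _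
    have n1 : ((e.1 : ℕ) : ZMod n) ≠ (g.1 : ℕ) := fun h => h1 <| by
      have h' := hval (hL e he).1 (hL g hg).1 h
      exact Prod.ext h' (by rw [← (hL e he).2, ← (hL g hg).2, h'])
    have n2 : ((e.1 : ℕ) : ZMod n) ≠ (g.2 : ℕ) := fun h => h2 <| by
      refine Prod.ext (hval (hL e he).1 hg2 h) ?_
      rw [← (hL e he).2, h, ← hpair g hg, hπ.invol, ZMod.val_cast_of_lt (hL g hg).1]
      rfl
    rcases hw with rfl | rfl
    · exact ⟨n1, by rwa [hpair g hg]⟩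
    · exact ⟨n2, by rwa [← hpair g hg, hπ.invol]⟩
  refine hπ.isGenericSlopes_of_ratio_ne hn (fun k => hc _ (ZMod.val_lt k)) (fun k => ?_)
    (fun k => ?_) fun w => ?_
  · rw [← ZMod.natCast_zmod_val k, hturn]
    exact hu _ (ZMod.val_lt k)
  · obtain ⟨e, he, rfl | rfl⟩ := hcov' k
    · rw [hct e he]
      exact hratio.1 e he
    · rw [← hpair e he, chordTurn_apply_chord hπ, hct e he]
      exact hratio.1 e he
  · obtain ⟨g, hg, hw⟩ := hcov' w
    obtain ⟨e, he, heg, heg', f, hf, hfg, hfg', hne⟩ := hratio.2 g hg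
    obtain ⟨h1, h2⟩ := hdiff e he g hg heg heg' w hw
    obtain ⟨h3, h4⟩ := hdiff f hf g hg hfg hfg' w hw
    refine ⟨_, _, h1, h2, h3, h4, ?_⟩
    rw [hct e he, hct f hf, hpair e he, hpair f hf, hturn, hturn, hturn, hturn]
    exact hne

lemma IsChordPairing.exists_of_allPairings_range {n m : ℕ} [NeZero n] {π : ZMod n → ZMod n}
    (hπ : IsChordPairing π) (hm : n = 2 * m) {Q : ℕ → ℕ → Prop} (hQ : ∀ t < n, Q t (π t).val)
    {P : List (ℕ × ℕ) → Prop} (h : AllPairings Q P m (List.range n) []) :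
    ∃ L : List (ℕ × ℕ), P L ∧ (∀ e ∈ L, e.1 < n ∧ (π e.1).val = e.2) ∧
      ∀ k < n, ∃ e ∈ L, k = e.1 ∨ k = e.2 :=
  hπ.exists_of_allPairings hQ m _ [] (by simpa using hm) List.nodup_range
    (fun k hk => ⟨List.mem_range.1 hk, List.mem_range.2 (ZMod.val_lt _)⟩) (by simp)
    (fun k hk => Or.inl (List.mem_range.2 hk)) h

/-- Signs cannot help here: with `t` negative chords the total `8 - 4 * t` is a multiple of three
only when it is zero. -/
lemma exists_isGenericSlopes_eight {π : ZMod 8 → ZMod 8} (hπ : IsChordPairing π) :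
    ∃ s, IsGenericSlopes π s := by
  have key : AllPairings (fun a b => b ≠ (a + 1) % 8 ∧ b ≠ (a + 7) % 8)
      (fun L => ∃ c ∈ ([[-1, 0, 1, -1, 0, 1, -1, 1], [-1, 0, -1, 1, -1, 1, -1, 1],
        [-1, 0, 1, -1, 0, -1, 0, 1]] : List (List ℤ)), c.length = 8 ∧
        (∀ k < 8, periodic c k = -1 ∨ periodic c k = 0 ∨ periodic c k = 1) ∧
        (∀ k < 8, periodic c (k + 7) - periodic c k ≠ 0) ∧
        RatioCondition (fun t => periodic c (t + 7) - periodic c t) L) 4 (List.range 8) [] := by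
    decide +kernel
  have hval : ∀ (k : ZMod 8) (t : ℕ), k.val = t % 8 → k = t := fun k t h => by
    rw [← ZMod.natCast_zmod_val k, h, ZMod.natCast_mod]
  obtain ⟨L, ⟨c, -, h1, h2, h3, h4⟩, hL, hcov⟩ := hπ.exists_of_allPairings_range rfl
    (fun t _ => ⟨fun h => hπ.ne_succ (t : ZMod 8) (by simpa using hval _ _ h),
      fun h => hπ.ne_pred (t : ZMod 8) (by
        rw [hval _ _ h]; push_cast; rw [sub_eq_add_neg]; rfl)⟩) key
  exact ⟨_, hπ.isGenericSlopes_of_ratioCondition (by norm_num) h1 h2 h3 hL hcov h4⟩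

/-- When all chord lengths are multiples of three, constant signs fail, and the only other total
divisible by three is zero. -/
lemma exists_isGenericSlopes_twelve {π : ZMod 12 → ZMod 12} (hπ : IsChordPairing π)
    (hmod : ∀ k, (π k).val % 3 = k.val % 3) {h : ZMod 12} (hh : π h ≠ h + 6) :
    ∃ s, IsGenericSlopes π s := by
  have key : AllPairings (fun a b => b % 3 = a % 3)
      (fun L => (∀ e ∈ L, e.2 = (e.1 + 6) % 12) ∨
        ∃ c ∈ ([[-1, 0, -1, 0, 1, -1, 0, 1, 0, 1, -1, 1],
          [-1, 0, -1, 1, -1, 0, -1, 0, -1, 1, -1, 0]] : List (List ℤ)), c.length = 12 ∧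
        (∀ k < 12, periodic c k = -1 ∨ periodic c k = 0 ∨ periodic c k = 1) ∧
        (∀ k < 12, periodic c (k + 11) - periodic c k ≠ 0) ∧
        RatioCondition (fun t => periodic c (t + 11) - periodic c t) L) 6 (List.range 12) [] := by
    decide +kernel
  obtain ⟨L, hP, hL, hcov⟩ := hπ.exists_of_allPairings_range rfl
    (fun t ht => by rw [hmod, ZMod.val_cast_of_lt ht]) key
  rcases hP with h' | ⟨c, -, h1, h2, h3, h4⟩
  · exfalso
    obtain ⟨e, he, hhe⟩ := hcov h.val (ZMod.val_lt h)
    have e1 : π (e.1 : ZMod 12) = (e.2 : ℕ) := by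
      rw [← (hL e he).2, ZMod.natCast_zmod_val]
    have e2 : ((e.2 : ℕ) : ZMod 12) = e.1 + 6 := by
      rw [h' e he, ZMod.natCast_mod]; push_cast; rfl
    apply hh
    rcases hhe with hhe | hhe <;> rw [← ZMod.natCast_zmod_val h, hhe]
    · rw [e1, e2]
    · rw [← e1, hπ.invol, e1, e2, add_assoc]
      exact (add_zero _).symm
  · exact ⟨_, hπ.isGenericSlopes_of_ratioCondition (by norm_num) h1 h2 h3 hL hcov h4⟩

end Small

/-! ### Cycles all of whose chords are diameters -/

section Antipodal

/-- Alternating slopes along half a cycle, ending with a horizontal edge. -/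
def halfSlope (m t : ℕ) : ℤ := if t + 1 = m then 0 else (-1) ^ t

/-- Slopes that change sign under the half turn. -/
def antipodalSlope (m : ℕ) (k : ZMod (2 * m)) : ℤ :=
  if k.val < m then halfSlope m k.val else -halfSlope m (k.val - m)

lemma halfSlope_mem (m t : ℕ) : halfSlope m t = -1 ∨ halfSlope m t = 0 ∨ halfSlope m t = 1 := by
  unfold halfSlope
  split_ifs
  · simp
  · rcases neg_one_pow_eq_or ℤ t with h | h <;> simp [h]

lemma antipodalSlope_mem (m : ℕ) (k : ZMod (2 * m)) :
    antipodalSlope m k = -1 ∨ antipodalSlope m k = 0 ∨ antipodalSlope m k = 1 := by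
  unfold antipodalSlope
  split_ifs
  · exact halfSlope_mem m _
  · have := halfSlope_mem m (k.val - m)
    omega

lemma halfSlope_succ_ne {m t : ℕ} (h : t + 1 < m) : halfSlope m (t + 1) ≠ halfSlope m t := by
  unfold halfSlope
  rw [if_neg (show ¬ t + 1 = m by omega), pow_succ]
  split_ifs <;> rcases neg_one_pow_eq_or ℤ t with h | h <;> simp [h]

lemma antipodalSlope_natCast {m t : ℕ} (ht : t < m) :
    antipodalSlope m (t : ℕ) = halfSlope m t := by
  rw [antipodalSlope, ZMod.val_cast_of_lt (by omega), if_pos ht]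

lemma antipodalSlope_natCast_add {m t : ℕ} (ht : t < m) :
    antipodalSlope m ((t + m : ℕ) : ZMod (2 * m)) = -halfSlope m t := by
  rw [antipodalSlope, ZMod.val_cast_of_lt (by omega), if_neg (by omega)]
  simp

lemma antipodalSlope_add (m : ℕ) [NeZero m] (k : ZMod (2 * m)) :
    antipodalSlope m (k + m) = -antipodalSlope m k := by
  have hk := ZMod.val_lt k
  rcases Nat.lt_or_ge k.val m with h | h
  · have e : k = ((k.val : ℕ) : ZMod (2 * m)) := (ZMod.natCast_zmod_val k).symm
    have e' : k + m = ((k.val + m : ℕ) : ZMod (2 * m)) := by rw [Nat.cast_add, ← e]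
    rw [e', antipodalSlope_natCast_add h]
    conv_rhs => rw [e, antipodalSlope_natCast h]
  · have e : k = ((k.val - m + m : ℕ) : ZMod (2 * m)) := by
      rw [Nat.sub_add_cancel h, ZMod.natCast_zmod_val]
    have e' : k + m = ((k.val - m : ℕ) : ZMod (2 * m)) := by
      have h0 : ((2 * m : ℕ) : ZMod (2 * m)) = 0 := ZMod.natCast_self _
      rw [Nat.cast_sub h, ZMod.natCast_zmod_val]
      push_cast at h0
      linear_combination h0
    rw [e', antipodalSlope_natCast (by omega)]
    conv_rhs => rw [e, antipodalSlope_natCast_add (by omega)]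
    simp

/-- Antisymmetry reduces this to the first half. At the junction slope 0 meets -1, whatever the
parity of `m`; this is what the final horizontal edge is for. -/
lemma antipodalSlope_succ_ne {m : ℕ} (hm : 2 ≤ m) (k : ZMod (2 * m)) :
    antipodalSlope m (k + 1) ≠ antipodalSlope m k := by
  have : NeZero m := ⟨by omega⟩
  suffices H : ∀ t : ℕ, t < m →
      antipodalSlope m ((t : ZMod (2 * m)) + 1) ≠ antipodalSlope m (t : ZMod (2 * m)) by
    have hk := ZMod.val_lt k
    have e : ((k.val : ℕ) : ZMod (2 * m)) = k := ZMod.natCast_zmod_val k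
    rcases Nat.lt_or_ge k.val m with h | h
    · have := H k.val h
      rwa [e] at this
    · have h' := H (k.val - m) (by omega)
      have e' : k = ((k.val - m : ℕ) : ZMod (2 * m)) + m := by
        rw [← Nat.cast_add, Nat.sub_add_cancel h, e]
      rw [e', add_right_comm, antipodalSlope_add, antipodalSlope_add]
      simpa using h'
  intro t ht
  rw [antipodalSlope_natCast ht]
  rcases Nat.lt_or_ge (t + 1) m with h | h
  · rw [← Nat.cast_succ, antipodalSlope_natCast h]
    exact halfSlope_succ_ne h
  · have ht' : t + 1 = m := by omega
    have e : (t : ZMod (2 * m)) + 1 = ((0 + m : ℕ) : ZMod (2 * m)) := by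
      rw [← Nat.cast_succ]; congr 1; omega
    rw [e, antipodalSlope_natCast_add (by omega)]
    simp only [halfSlope, if_pos ht', if_neg (show ¬ 0 + 1 = m by omega)]
    norm_num

/-- Opposite turns at the ends of each chord make the closing equation void, so each chord moves
freely. A line form is then nonzero once some chord avoiding the far vertex has exactly one end on
the arc. -/
theorem isGenericSlopes_antipodal {m : ℕ} [NeZero m] (hm : 2 ≤ m)
    {π : ZMod (2 * m) → ZMod (2 * m)} (hπ : IsChordPairing π) (hanti : ∀ k, π k = k + m) :
    IsGenericSlopes π (antipodalSlope m) := by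
  set s := antipodalSlope m with hs
  have hturn : ∀ k, turn s k ≠ 0 := fun k => by
    have := antipodalSlope_succ_ne hm (k - 1)
    rw [sub_add_cancel] at this
    exact sub_ne_zero.2 this.symm
  have hturn' : ∀ k, turn s (π k) = -turn s k := fun k => by
    rw [hanti, turn, turn, hs, antipodalSlope_add, add_sub_right_comm, antipodalSlope_add]
    ring
  have hclosing : ∀ k, IsClosing π s (chordIndicator π k) := fun k =>
    ⟨hπ.chordIndicator_apply k, by
      simp only [Int.cast_id]
      rw [sum_mul_chordIndicator]
      simp [hturn']⟩
  refine ⟨antipodalSlope_mem m, fun j k h1 h2 => ⟨_, hclosing j, ?_⟩, fun i d hd1 hd2 => ?_⟩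
  · have h3 : k ≠ π j := fun h => h2 (by rw [h, hπ.invol])
    simp [chordIndicator, (hπ.ne_self j).symm, h1.symm, h3]
  · have hform : ∀ k, i + 1 + (d : ZMod (2 * m)) ≠ k → i + 1 + (d : ZMod (2 * m)) ≠ π k →
        lineForm s i d (chordIndicator π k) = (if k ∈ arc i d then turn s k else 0) +
          (if π k ∈ arc i d then turn s (π k) else 0) := by
      intro k h1 h2
      have h0 : chordIndicator π k (i + 1 + d) = 0 := by simp [chordIndicator, h1, h2]
      rw [lineForm_eq_sum_arc s i (by omega), sum_mul_chordIndicator, h0, mul_zero, add_zero]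
    have hinj : ∀ {t : ℕ}, t < 2 * m → i + 1 + (d : ZMod (2 * m)) = i + 1 + (t : ZMod (2 * m)) →
        d = t := fun ht h => natCast_injOn_lt (by omega) ht (add_left_cancel h)
    -- A short arc contains `i + 1` but not its antipode; a long one contains the antipode of `i`
    -- but not `i`.
    rcases Nat.lt_or_ge d m with h | h
    · refine ⟨_, hclosing (i + 1), ?_⟩
      rw [hform, if_pos (succ_mem_arc i hd1), hanti, if_neg, add_zero]
      · exact hturn _
      · rw [add_natCast_mem_arc_iff i (by omega) (by omega)]
        omega
      · intro h'
        have := hinj (t := 0) (by omega) (by simpa using h')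
        omega
      · rw [hanti]
        intro h'
        have := hinj (by omega) h'
        omega
    · have e : π i = i + 1 + ((m - 1 : ℕ) : ZMod (2 * m)) := by
        rw [hanti, Nat.cast_sub (by omega)]; push_cast; ring
      refine ⟨_, hclosing i, ?_⟩
      rw [hform, if_neg (self_notMem_arc i (by omega)), if_pos, zero_add]
      · exact hturn _
      · rw [e, add_natCast_mem_arc_iff i (by omega) (by omega)]
        omega
      · intro h'
        have := hinj (t := 2 * m - 1) (by omega) (by
          rw [← self_eq_add_natCast i (by omega)]; exact h')
        omega
      · rw [e]
        intro h'
        have := hinj (by omega) h'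
        omega

end Antipodal

/-! ### The main theorem -/

lemma IsChordPairing.even {n : ℕ} [NeZero n] {π : ZMod n → ZMod n} (hπ : IsChordPairing π) :
    Even n := by
  have h : ∑ _k : ZMod n, (1 : ZMod 2) = 0 :=
    Finset.sum_involution (fun k _ => π k) (fun _ _ => CharTwo.add_self_eq_zero _)
      (fun k _ _ => hπ.ne_self k) (fun _ _ => Finset.mem_univ _) (fun k _ => hπ.invol k)
  rw [Finset.sum_const, Finset.card_univ, ZMod.card, nsmul_one] at h
  exact (ZMod.natCast_eq_zero_iff_even).1 h

/-- Every chord pairing of a cycle of length at least six has generic slopes. -/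
theorem IsChordPairing.exists_isGenericSlopes {n : ℕ} [NeZero n] {π : ZMod n → ZMod n}
    (hπ : IsChordPairing π) (hn : 6 ≤ n) : ∃ s, IsGenericSlopes π s := by
  obtain ⟨m, hm⟩ := hπ.even
  obtain rfl : n = 2 * m := by omega
  have : NeZero m := ⟨by omega⟩
  by_cases hanti : ∀ k, π k = k + m
  · exact ⟨_, isGenericSlopes_antipodal (by omega) hπ hanti⟩
  push Not at hanti
  obtain ⟨h, hh⟩ := hanti
  have hh' : ∀ d : ℕ, 2 * d = 2 * m → π h ≠ h + d := fun d hd => by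
    obtain rfl : d = m := by omega
    exact hh
  -- In the three cases `n - 4 * (j + 1)` is divisible by three for `j = 2`, `1`, `0` respectively,
  -- and vanishes only for `n = 12`, `8`, `4`.
  rcases (by omega : m % 3 = 0 ∨ m % 3 = 1 ∨ m % 3 = 2) with h3 | h3 | h3
  -- Here constant signs have total `n`, a multiple of three, and work as soon as some chord length
  -- is not one.
  · by_cases hd : ∃ k, ¬ 3 ∣ (π k - k).val
    · obtain ⟨k, hk⟩ := hd
      refine hπ.exists_isGenericSlopes_of_finset (by omega) (F := ∅) (by simp) ?_ ?_
        (ZMod.val_lt (π k - k)).le (by rw [ZMod.natCast_zmod_val]; ring) ?_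
      · simp only [Finset.card_empty]; omega
      · simp only [Finset.card_empty]; omega
      · simp only [Finset.inter_empty, Finset.card_empty]; omega
    push Not at hd
    rcases (by omega : m = 3 ∨ m = 6 ∨ 9 ≤ m) with rfl | rfl | hm9
    · exfalso
      have h1 := hd h
      have h2 := ZMod.val_lt (π h - h)
      have h4 : (π h - h).val ≠ 0 := fun h' =>
        hπ.ne_self h (sub_eq_zero.1 ((ZMod.val_eq_zero _).1 h'))
      have h5 : (π h - h).val = 3 := by omega
      exact hh' (π h - h).val (by omega) (by rw [ZMod.natCast_zmod_val]; ring)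
    · refine exists_isGenericSlopes_twelve hπ (fun k => ?_) (h := h) hh
      have h1 : (π k).val = (k.val + (π k - k).val) % 12 := by
        rw [← ZMod.val_add, add_sub_cancel]
      have := hd k
      omega
    · exact hπ.exists_isGenericSlopes_of_not_antipodal (j := 2) (by omega) (by omega) (by omega)
        (by omega) hh'
  · rcases (by omega : m = 4 ∨ 7 ≤ m) with rfl | hm7
    · exact exists_isGenericSlopes_eight hπ
    · exact hπ.exists_isGenericSlopes_of_not_antipodal (j := 1) (by omega) (by omega) (by omega)
        (by omega) hh'
  · exact hπ.exists_isGenericSlopes_of_not_antipodal (j := 0) (by omega) (by omega) (by omega)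
      (by omega) hh'

theorem corollary2p12 {V : Type*} [Fintype V] [DecidableEq V]
    (G : SimpleGraph V) [DecidableRel G.Adj]
    (hcubic : G.IsRegularOfDegree 3)
    (hham : ∃ (a : V) (p : G.Walk a a), p.IsHamiltonianCycle) :
    ∃ D : StraightLineDrawing G, D.UsesOnlySlopes basicSlopes := by
  obtain ⟨a, p, hp⟩ := hham
  have hcard : 4 ≤ Fintype.card V := by
    have := G.degree_lt_card_verts a
    rw [hcubic a] at this
    omega
  have : NeZero (Fintype.card V) := ⟨by omega⟩
  obtain ⟨v, hv⟩ := exists_cyclic_labelling hp rfl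
  obtain ⟨π, hπ, hadj⟩ := exists_chordPairing hcubic (by omega) v hv
  by_cases h4 : Fintype.card V = 4
  · exact exists_drawing_of_equiv_fin_four G (Fintype.equivFinOfCardEq h4)
  · obtain ⟨m, hm⟩ := hπ.even
    obtain ⟨s, hs⟩ := hπ.exists_isGenericSlopes (by omega)
    exact hs.exists_drawing v hπ hadj
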